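/- Let $1<p<\infty$, $\frac1p+\frac1{p'}=1$, $s>0$, let $\psi$ be a continuous real function on $[1,\infty)$, and put $g_{s,p}(t)=\psi(t)\,t^{s+1/p}$. **Definitions.** $\|\varphi\|_p=\big(\int_0^{2\pi}|\varphi|^p\,dt\big)^{1/p}$ for $2\pi$-periodic real functions. For $\beta\in\mathbb R$ let $\Psi_\beta$ be a summable $2\pi$-periodic function with Fourier series $\sum_{k=1}^\infty\psi(k)\cos\big(kt-\frac{\beta\pi}2\big)$. If $\Psi_\beta\in L_{p'}$, then $C^\psi_{\beta,p}$ is the class of all functions $$f(x)=\frac{a_0}2+\frac1\pi\int_{-\pi}^{\pi}\Psi_\beta(x-t)\varphi(t)\,dt,\qquad a_0\in\mathbb R,\quad \|\varphi\|_p\le 1,\quad \int_{-\pi}^{\pi}\varphi(t)\,dt=0 .$$ With $a_k(f),b_k(f)$ the Fourier coefficients of $f$, set $$Z_n^s(f;x)=\frac{a_0(f)}2+\sum_{k=1}^{n-1}\Big(1-\big(\tfrac kn\big)^s\Big)\big(a_k(f)\cos kx+b_k(f)\sin kx\big),\qquad \mathcal E_n(C^\psi_{\beta,p};Z_n^s)_C=\sup_{f\in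 C^\psi_{\beta,p}}\ \max_x|f(x)-Z_n^s(f;x)| .$$ Moreover: * $\psi\in\Theta_p$ means that $\psi$ is non-increasing on $[1,\infty)$ and there are $\alpha>\frac1p$ and $K>0$ with $t_1^\alpha\psi(t_1)\le K t_2^\alpha\psi(t_2)$ for all $t_1>t_2\ge1$. * $g\in A^+$ (respectively $g\in A^-$) means that $g>0$ on $[1,\infty)$ and for some $\varepsilon>0$ the function $g(t)t^{-\varepsilon}$ is non-decreasing (respectively $g(t)t^{\varepsilon}$ is non-increasing) on $[1,\infty)$. * $g\in\mathcal Z$ ($g$ is slowly varying in Zygmund's sense) means that $g$ is continuous and positive on $[1,\infty)$ and, for every $\delta>0$, $g(t)t^{\delta}$ is non-decreasing and $g(t)t^{-\delta}$ is non-increasing for all sufficiently large $t$. **Theorem.** In each of the following three cases the kernel $\Psi_\beta$ exists and lies in $L_{p'}$ for every $\beta\in\mathbb R$, and there is a constant $K>0$, depending only on $\psi$, $p$ and $s$ (not on $\beta$ or $n$), such that the stated inequality holds for all $\beta\in\mathbb R$ and all indicated $n$. 1. If $\psi\in\Theta_p$ and $g_{s,p}\in A^+$, then $\mathcal E_n(C^\psi_{\beta,p};Z_n^s)_C\le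 K\,\psi(n)\,n^{1/p}$ for all $n\in\mathbb N$, $n\ge 1$. 2. If $g_{s,p}\in\mathcal Z$, then $$\mathcal E_n(C^\psi_{\beta,p};Z_n^s)_C\le \frac{K}{n^s}\Big(\int_1^n\frac{g_{s,p}^{\,p'}(t)}t\,dt\Big)^{1/p'}\quad\text{for all } n\ge 2 .$$ 3. If $g_{s,p}\in A^-$, then $\mathcal E_n(C^\psi_{\beta,p};Z_n^s)_C\le K\,n^{-s}$ for all $n\in\mathbb N$, $n\ge 1$. -/

import Mathlib

open MeasureTheory Set
open scoped Real ENNReal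

namespace ZygmundApprox

/-- Lebesgue measure on one period. All functions below are `2π`-periodic, so
`‖f‖_p = (∫_0^{2π} |f|^p)^{1/p}` may be computed over `(-π, π]`. -/
noncomputable def periodMeasure : Measure ℝ := volume.restrict (Ioc (-π) π)

/-- The Fourier coefficient `a_k(f)`. -/
noncomputable def cosCoeff (f : ℝ → ℝ) (k : ℕ) : ℝ :=
  (1 / π) * ∫ t in (-π)..π, f t * Real.cos (k * t)

/-- The Fourier coefficient `b_k(f)`. -/
noncomputable def sinCoeff (f : ℝ → ℝ) (k : ℕ) : ℝ :=
  (1 / π) * ∫ t in (-π)..π, f t * Real.sin (k * t)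

/-- The Zygmund sum `Z_n^s(f; x)`. -/
noncomputable def zygmundSum (s : ℝ) (n : ℕ) (f : ℝ → ℝ) (x : ℝ) : ℝ :=
  cosCoeff f 0 / 2 + ∑ k ∈ Finset.Ico 1 n, (1 - ((k : ℝ) / n) ^ s) *
    (cosCoeff f k * Real.cos (k * x) + sinCoeff f k * Real.sin (k * x))

/-- `Ψ` is a summable `2π`-periodic function whose Fourier series is
`∑_{k ≥ 1} ψ(k) cos (k t - β π / 2)`, where
`cos (k t - β π / 2) = cos (β π / 2) cos (k t) + sin (β π / 2) sin (k t)`. -/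
structure IsKernel (ψ : ℝ → ℝ) (β : ℝ) (Ψ : ℝ → ℝ) : Prop where
  periodic : Function.Periodic Ψ (2 * π)
  integrable : Integrable Ψ periodMeasure
  cosCoeff_zero : cosCoeff Ψ 0 = 0
  cosCoeff_eq : ∀ k : ℕ, 1 ≤ k → cosCoeff Ψ k = ψ k * Real.cos (β * π / 2)
  sinCoeff_eq : ∀ k : ℕ, 1 ≤ k → sinCoeff Ψ k = ψ k * Real.sin (β * π / 2)

/-- The kernel `Ψ_β` exists and belongs to `L_{p'}`, where `p' = p / (p - 1)`. -/
def HasKernel (ψ : ℝ → ℝ) (β p : ℝ) : Prop :=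
  ∃ Ψ : ℝ → ℝ, IsKernel ψ β Ψ ∧ MemLp Ψ (ENNReal.ofReal p.conjExponent) periodMeasure

/-- The class `C^ψ_{β,p}`. -/
def convClass (ψ : ℝ → ℝ) (β p : ℝ) : Set (ℝ → ℝ) :=
  {f | ∃ Ψ : ℝ → ℝ, IsKernel ψ β Ψ ∧ MemLp Ψ (ENNReal.ofReal p.conjExponent) periodMeasure ∧
    ∃ (a₀ : ℝ) (φ : ℝ → ℝ), Function.Periodic φ (2 * π) ∧
      MemLp φ (ENNReal.ofReal p) periodMeasure ∧
      eLpNorm φ (ENNReal.ofReal p) periodMeasure ≤ 1 ∧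
      (∫ t in (-π)..π, φ t) = 0 ∧
      ∀ x, f x = a₀ / 2 + (1 / π) * ∫ t in (-π)..π, Ψ (x - t) * φ t}

/-- `𝓔_n(C^ψ_{β,p}; Z_n^s)_C`, the supremum over the class of the uniform norm of `f - Z_n^s(f)`. -/
noncomputable def zygmundError (ψ : ℝ → ℝ) (β p s : ℝ) (n : ℕ) : ℝ≥0∞ :=
  ⨆ f ∈ convClass ψ β p, ⨆ x : ℝ, ENNReal.ofReal |f x - zygmundSum s n f x|

/-- The set `Θ_p`. -/
def Theta (p : ℝ) : Set (ℝ → ℝ) :=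
  {ψ | AntitoneOn ψ (Ici 1) ∧ ∃ α : ℝ, 1 / p < α ∧ ∃ K : ℝ, 0 < K ∧ ∀ t₁ t₂ : ℝ, 1 ≤ t₂ → t₂ < t₁ →
    t₁ ^ α * ψ t₁ ≤ K * (t₂ ^ α * ψ t₂)}

/-- The set `A⁺`. -/
def APlus : Set (ℝ → ℝ) :=
  {g | (∀ t, 1 ≤ t → 0 < g t) ∧ ∃ ε : ℝ, 0 < ε ∧ MonotoneOn (fun t : ℝ => g t * t ^ (-ε)) (Ici 1)}

/-- The set `A⁻`. -/
def AMinus : Set (ℝ → ℝ) :=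
  {g | (∀ t, 1 ≤ t → 0 < g t) ∧ ∃ ε : ℝ, 0 < ε ∧ AntitoneOn (fun t : ℝ => g t * t ^ ε) (Ici 1)}

/-- Continuous slowly varying functions on `[1, ∞)` in the sense of Zygmund. -/
def SlowlyVarying : Set (ℝ → ℝ) :=
  {g | ContinuousOn g (Ici 1) ∧ (∀ t, 1 ≤ t → 0 < g t) ∧
    ∀ δ : ℝ, 0 < δ → ∃ T : ℝ, 1 ≤ T ∧ MonotoneOn (fun t : ℝ => g t * t ^ δ) (Ici T) ∧
      AntitoneOn (fun t : ℝ => g t * t ^ (-δ)) (Ici T)}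

/-- The function `g_{s,p}(t) = ψ(t) t^{s + 1/p}`. -/
noncomputable def gFun (ψ : ℝ → ℝ) (s p : ℝ) (t : ℝ) : ℝ := ψ t * t ^ (s + 1 / p)

end ZygmundApprox

open ZygmundApprox

/-! Convolution turns the approximation error into a kernel estimate. For `f` in the class, `f -
Z_n^s f` is `1/π` times the convolution of `φ` with `Ψ_β` minus a trigonometric polynomial, and this
difference is the cosine series with coefficients `w_k = min((k/n)^s, 1) ψ(k)`. With `q = p'`,
Hölder's inequality bounds the error by a constant times the `L_q` norm of that series.

The norm is controlled by a Hardy–Littlewood inequality, `‖∑ w_k cos(ku - γ)‖_q^q ≤ K ∑ k^(q-2)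
w_k^q`. The sequence `w` need not be monotone: it may grow up to `k = n`. The condition `w_{k+1} ≤
(1 + C/k) w_k` is therefore used instead of monotonicity, and `C` can be chosen independent of `n`
(`exists_regular_errorCoeff`). On the shell `π/(m+1) < |u| ≤ π/m`, summation by parts bounds the
series by a multiple of `∑ min(1, m/k) w_k`. The shell has measure at most `2π/m²`, and a discrete
Hardy inequality, obtained from Schur's test, sums the bounds
(`Regular.exists_lintegral_cosSeries_le`). The same pointwise bounds give an integrable majorant of
the partial sums, so the series has the prescribed Fourier coefficients; uniqueness of these
coefficients identifies it with any kernel `Ψ_β`.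

It remains to estimate `∑ k⁻¹ (w_k k^(1/p))^q`. Here `w_k k^(1/p)` equals `n^(-s) g(k)` for `k ≤ n`
and `n^(-s) (n/k)^s g(k)` for `k ≥ n`. In case 1 it decays like a power on both sides of `k = n`, in
case 3 it decays from `k = 1` on, and for slowly varying `g` the terms below `n` add up to the
integral of the theorem. -/

open Filter Topology

namespace ZygmundApprox

/-! ### Schur's test and the discrete Hardy inequality -/

/-- Jensen's inequality for weighted series in `ℝ≥0∞`. -/
theorem ENNReal_tsum_mul_rpow_le {ι : Type*} {q : ℝ} (hq : 1 ≤ q) (w f : ι → ℝ≥0∞) :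
    (∑' i, w i * f i) ^ q ≤ (∑' i, w i) ^ (q - 1) * ∑' i, w i * f i ^ q := by
  have hq0 : 0 < q := by linarith
  have key : ∑' i, w i * f i ≤ (∑' i, w i) ^ (1 - q⁻¹) * (∑' i, w i * f i ^ q) ^ q⁻¹ := by
    rw [ENNReal.tsum_eq_iSup_sum]
    refine iSup_le fun s => (ENNReal.inner_le_weight_mul_Lp_of_nonneg s hq w f).trans ?_
    have : 0 ≤ 1 - q⁻¹ := sub_nonneg.2 (inv_le_one_of_one_le₀ hq)
    gcongr
    · exact ENNReal.sum_le_tsum s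
    · exact ENNReal.sum_le_tsum s
  calc (∑' i, w i * f i) ^ q ≤ ((∑' i, w i) ^ (1 - q⁻¹) * (∑' i, w i * f i ^ q) ^ q⁻¹) ^ q := by
        gcongr
    _ = _ := by
        rw [ENNReal.mul_rpow_of_nonneg _ _ hq0.le, ← ENNReal.rpow_mul, ← ENNReal.rpow_mul,
          inv_mul_cancel₀ hq0.ne', ENNReal.rpow_one, sub_mul, inv_mul_cancel₀ hq0.ne', one_mul]

/-- Schur's test for a symmetric kernel with respect to a discrete measure. -/
theorem tsum_rpow_le_of_symm {ι : Type*} {q : ℝ} (hq : 1 ≤ q) (K : ι → ι → ℝ≥0∞) (μ x : ι → ℝ≥0∞)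
    (A : ℝ≥0∞) (hA' : A ≠ ⊤) (hsymm : ∀ m k, K m k = K k m) (hK : ∀ m, μ m ≠ 0 → ∑' k, K m k * μ k ≤ A) :
    ∑' m, μ m * (∑' k, K m k * μ k * x k) ^ q ≤ A ^ q * ∑' k, μ k * x k ^ q := by
  have hq1 : 0 ≤ q - 1 := by linarith
  -- Jensen's inequality with row mass at most `A` gives the factor `A ^ (q - 1)`; exchanging the
  -- sums and using symmetry gives the last factor `A`.
  calc ∑' m, μ m * (∑' k, K m k * μ k * x k) ^ q
      ≤ ∑' m, μ m * (A ^ (q - 1) * ∑' k, K m k * μ k * x k ^ q) := by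
        refine ENNReal.tsum_le_tsum fun m => ?_
        rcases eq_or_ne (μ m) 0 with h | h
        · simp [h]
        gcongr
        refine (ENNReal_tsum_mul_rpow_le hq _ _).trans ?_
        gcongr
        exact hK m h
    _ = A ^ (q - 1) * ∑' k, μ k * x k ^ q * ∑' m, K k m * μ m := by
        simp_rw [← ENNReal.tsum_mul_left]
        rw [ENNReal.tsum_comm]
        refine tsum_congr fun k => tsum_congr fun m => ?_
        rw [hsymm m k]; ring
    _ ≤ A ^ (q - 1) * ∑' k, μ k * x k ^ q * A := by
        gcongr A ^ (q - 1) * ?_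
        refine ENNReal.tsum_le_tsum fun k => ?_
        rcases eq_or_ne (μ k) 0 with h | h
        · simp [h]
        gcongr
        exact hK k h
    _ = A ^ q * ∑' k, μ k * x k ^ q := by
        rw [ENNReal.tsum_mul_right, mul_comm (∑' k, _) A, ← mul_assoc]
        congr 1
        rcases eq_or_ne A 0 with rfl | hA
        · rw [mul_zero, ENNReal.zero_rpow_of_pos (by linarith)]
        conv_lhs => rw [← ENNReal.rpow_one A, ← ENNReal.rpow_mul, one_mul, ← ENNReal.rpow_add _ _ hA hA']
        congr 1; ring

/-- The homogeneous kernel `(min (m, k) / max (m, k)) ^ c`. -/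
noncomputable def ratioKernel (c : ℝ) (m k : ℕ) : ℝ := ((min m k : ℕ) / (max m k : ℕ) : ℝ) ^ c

theorem ratioKernel_comm (c : ℝ) (m k : ℕ) : ratioKernel c m k = ratioKernel c k m := by
  rw [ratioKernel, ratioKernel, min_comm, max_comm]

theorem ratioKernel_nonneg (c : ℝ) (m k : ℕ) : 0 ≤ ratioKernel c m k := by
  unfold ratioKernel; positivity

theorem ratioKernel_of_le (c : ℝ) {m k : ℕ} (h : k ≤ m) : ratioKernel c m k = ((k : ℝ) / m) ^ c := by
  rw [ratioKernel, min_eq_right h, max_eq_left h]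

theorem ratioKernel_of_ge (c : ℝ) {m k : ℕ} (h : m ≤ k) : ratioKernel c m k = ((m : ℝ) / k) ^ c := by
  rw [ratioKernel, min_eq_left h, max_eq_right h]

/-- Bernoulli's inequality for an exponent at most one. It makes the sums of `ratioKernel c m k / k`
telescope. -/
theorem div_rpow_succ_le {c : ℝ} (hc : 0 < c) (hc1 : c ≤ 1) (k : ℕ) :
    ((k : ℝ) / (k + 1 : ℕ)) ^ c ≤ 1 - c / (k + 1 : ℕ) := by
  have hk : (0 : ℝ) < (k + 1 : ℕ) := by positivity
  have h := rpow_one_add_le_one_add_mul_self (s := -1 / ((k + 1 : ℕ) : ℝ)) (p := c)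
    (by rw [le_div_iff₀ hk]; push_cast; linarith [(Nat.cast_nonneg k : (0 : ℝ) ≤ k)]) hc.le hc1
  have e : 1 + -1 / ((k + 1 : ℕ) : ℝ) = (k : ℝ) / (k + 1 : ℕ) := by
    field_simp; push_cast; ring
  rw [e] at h
  refine h.trans (le_of_eq ?_)
  ring

/-- Discrete form of `∫_0^N (t/m)^c dt/t = (N/m)^c / c`. The term `k = 0` vanishes because division
by zero is zero. -/
theorem sum_ratioKernel_le_left {c : ℝ} (hc : 0 < c) (hc1 : c ≤ 1) {m N : ℕ} (hm : 1 ≤ m) (hN : N ≤ m) :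
    ∑ k ∈ Finset.range (N + 1), ratioKernel c m k / k ≤ ((N : ℝ) / m) ^ c / c := by
  induction N with
  | zero => simp; positivity
  | succ N ih =>
    rw [Finset.sum_range_succ]
    have ih := ih (by omega)
    rw [ratioKernel_of_le c hN]
    have h := div_rpow_succ_le hc hc1 N
    have hN0 : (0 : ℝ) < (N + 1 : ℕ) := by positivity
    have hm0 : (0 : ℝ) < m := by positivity
    have e : ((N : ℝ) / m) ^ c = ((N : ℝ) / (N + 1 : ℕ)) ^ c * (((N + 1 : ℕ) : ℝ) / m) ^ c := by
      rw [← Real.mul_rpow (by positivity) (by positivity)]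
      congr 1; field_simp
    rw [e] at ih
    have hX : 0 ≤ (((N + 1 : ℕ) : ℝ) / m) ^ c := by positivity
    set X := (((N + 1 : ℕ) : ℝ) / m) ^ c
    have h2 := mul_le_mul_of_nonneg_right h hX
    have h3 : ((N : ℝ) / (N + 1 : ℕ)) ^ c * X / c ≤ (1 - c / (N + 1 : ℕ)) * X / c := by gcongr
    have h4 : (1 - c / (N + 1 : ℕ)) * X / c = X / c - X / (N + 1 : ℕ) := by field_simp
    linarith

/-- Indices up to `m` contribute at most `1/c`; beyond `m` the model is `∫_m^N (m/t)^c dt/t = (1 -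
(m/N)^c)/c`. -/
theorem sum_ratioKernel_le_right {c : ℝ} (hc : 0 < c) (hc1 : c ≤ 1) {m N : ℕ} (hm : 1 ≤ m) (hN : m ≤ N) :
    ∑ k ∈ Finset.range (N + 1), ratioKernel c m k / k ≤ 2 / c - ((m : ℝ) / N) ^ c / c := by
  have hm0 : (0 : ℝ) < m := by positivity
  induction N, hN using Nat.le_induction with
  | base =>
    refine (sum_ratioKernel_le_left hc hc1 hm le_rfl).trans (le_of_eq ?_)
    rw [div_self hm0.ne', Real.one_rpow]; ring
  | succ N hN ih =>
    rw [Finset.sum_range_succ, ratioKernel_of_ge c (by omega : m ≤ N + 1)]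
    have h := div_rpow_succ_le hc hc1 N
    have hN1 : (0 : ℝ) < (N + 1 : ℕ) := by positivity
    have hN0 : (0 : ℝ) < N := by exact_mod_cast (by omega : 0 < N)
    have e : ((m : ℝ) / (N + 1 : ℕ)) ^ c = ((N : ℝ) / (N + 1 : ℕ)) ^ c * ((m : ℝ) / N) ^ c := by
      rw [← Real.mul_rpow (by positivity) (by positivity)]
      congr 1; field_simp
    have hX : 0 ≤ ((m : ℝ) / N) ^ c := by positivity
    rw [e]
    set X := ((m : ℝ) / N) ^ c
    set Y := ((N : ℝ) / (N + 1 : ℕ)) ^ c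
    have hY : 0 ≤ Y := by positivity
    set r := 1 / ((N + 1 : ℕ) : ℝ) with hr
    have hr0 : 0 < r := by positivity
    have h' : Y ≤ 1 - c * r := by rw [hr]; simpa [div_eq_mul_inv] using h
    have key : Y * X * r ≤ X / c - Y * X / c := by
      rw [← sub_div, le_div_iff₀ hc]
      have : Y * (1 + c * r) ≤ 1 := by
        calc Y * (1 + c * r) ≤ (1 - c * r) * (1 + c * r) := by gcongr
          _ ≤ 1 := by nlinarith [sq_nonneg (c * r)]
      nlinarith [mul_le_mul_of_nonneg_right this hX]
    have e2 : Y * X / ((N + 1 : ℕ) : ℝ) = Y * X * r := by rw [hr]; ring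
    rw [e2]; linarith

theorem tsum_ratioKernel_le {c : ℝ} (hc : 0 < c) (hc1 : c ≤ 1) {m : ℕ} (hm : 1 ≤ m) :
    ∑' k : ℕ, ENNReal.ofReal (ratioKernel c m k) * ENNReal.ofReal (1 / k) ≤ ENNReal.ofReal (2 / c) := by
  rw [ENNReal.tsum_eq_iSup_nat]
  refine iSup_le fun N => ?_
  calc ∑ k ∈ Finset.range N, ENNReal.ofReal (ratioKernel c m k) * ENNReal.ofReal (1 / k)
      ≤ ∑ k ∈ Finset.range (max m N + 1), ENNReal.ofReal (ratioKernel c m k) * ENNReal.ofReal (1 / k) :=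
        Finset.sum_le_sum_of_subset (Finset.range_mono (by omega))
    _ = ENNReal.ofReal (∑ k ∈ Finset.range (max m N + 1), ratioKernel c m k / k) := by
        rw [ENNReal.ofReal_sum_of_nonneg fun k _ => div_nonneg (ratioKernel_nonneg c m k) k.cast_nonneg]
        refine Finset.sum_congr rfl fun k _ => ?_
        rw [← ENNReal.ofReal_mul (ratioKernel_nonneg c m k)]; congr 1; ring
    _ ≤ _ := by
        refine ENNReal.ofReal_le_ofReal ((sum_ratioKernel_le_right hc hc1 hm (le_max_left _ _)).trans ?_)
        have : 0 ≤ ((m : ℝ) / (max m N : ℕ)) ^ c / c := by positivity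
        linarith

/-- The weighted norm `∑ k ^ (q - 2) * w k ^ q` of Hardy and Littlewood, where `1 / p + 1 / q = 1`. -/
noncomputable def energy (p q : ℝ) (w : ℕ → ℝ) : ℝ≥0∞ :=
  ∑' k : ℕ, ENNReal.ofReal (1 / k) * ENNReal.ofReal (w k * (k : ℝ) ^ (1 / p)) ^ q

/-- The averaging operator `∑ min (1, m / k) * w k`. -/
noncomputable def hardySum (w : ℕ → ℝ) (m : ℕ) : ℝ≥0∞ :=
  ∑' k : ℕ, ENNReal.ofReal (min 1 ((m : ℝ) / k) * w k)

/-- After weighting, the averaging operator has a homogeneous kernel: `m^(-1/q) min(1, m/k)` is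
`k^(-1/q)` times `(k/m)^(1/q)` for `k ≤ m` and times `(m/k)^(1/p)` for `k ≥ m`. The smaller of the
two exponents serves both sides. -/
theorem rpow_mul_min_le {p q c : ℝ} (hpq : p.HolderConjugate q) (hcp : c ≤ 1 / p) (hcq : c ≤ 1 / q)
    {m k : ℕ} (hm : 1 ≤ m) {x : ℝ} (hx : 0 ≤ x) :
    (m : ℝ) ^ (-(1 / q)) * (min 1 ((m : ℝ) / k) * x) ≤
      ratioKernel c m k * (1 / k) * (x * (k : ℝ) ^ (1 / p)) := by
  rcases Nat.eq_zero_or_pos k with rfl | hk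
  · simp
  have hm0 : (0 : ℝ) < m := by exact_mod_cast hm
  have hk0 : (0 : ℝ) < k := by exact_mod_cast hk
  have hpq1 : 1 / p + 1 / q = 1 := by simpa using hpq.inv_add_inv_eq_one
  suffices h : (m : ℝ) ^ (-(1 / q)) * min 1 ((m : ℝ) / k) ≤
      ratioKernel c m k * (1 / k) * (k : ℝ) ^ (1 / p) by
    calc _ = (m : ℝ) ^ (-(1 / q)) * min 1 ((m : ℝ) / k) * x := by ring
      _ ≤ ratioKernel c m k * (1 / k) * (k : ℝ) ^ (1 / p) * x := by gcongr
      _ = _ := by ring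
  have hkp : (1 / (k : ℝ)) * (k : ℝ) ^ (1 / p) = (k : ℝ) ^ (-(1 / q)) := by
    rw [show -(1 / q) = -1 + 1 / p by linarith, Real.rpow_add hk0, Real.rpow_neg_one, one_div]
  rw [mul_assoc, hkp]
  rcases le_total k m with h | h
  · have hkm : (k : ℝ) ≤ m := by exact_mod_cast h
    rw [ratioKernel_of_le c h, min_eq_left ((one_le_div hk0).2 hkm), mul_one]
    have h1 : ((k : ℝ) / m) ^ (1 / q) ≤ ((k : ℝ) / m) ^ c :=
      Real.rpow_le_rpow_of_exponent_ge (by positivity) ((div_le_one hm0).2 hkm) hcq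
    calc (m : ℝ) ^ (-(1 / q)) = ((k : ℝ) / m) ^ (1 / q) * (k : ℝ) ^ (-(1 / q)) := by
          rw [Real.div_rpow hk0.le hm0.le, Real.rpow_neg hk0.le, Real.rpow_neg hm0.le]
          field_simp
      _ ≤ _ := by gcongr
  · have hkm : (m : ℝ) ≤ k := by exact_mod_cast h
    rw [ratioKernel_of_ge c h, min_eq_right ((div_le_one hk0).2 hkm)]
    have h1 : ((m : ℝ) / k) ^ (1 / p) ≤ ((m : ℝ) / k) ^ c :=
      Real.rpow_le_rpow_of_exponent_ge (by positivity) ((div_le_one hk0).2 hkm) hcp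
    calc (m : ℝ) ^ (-(1 / q)) * (m / k) = ((m : ℝ) / k) ^ (1 / p) * (k : ℝ) ^ (-(1 / q)) := by
          rw [Real.div_rpow hm0.le hk0.le, show -(1 / q) = -1 + 1 / p by linarith,
            Real.rpow_add hm0, Real.rpow_add hk0, Real.rpow_neg_one, Real.rpow_neg_one]
          field_simp
      _ ≤ _ := by gcongr

/-- The discrete Hardy inequality. -/
theorem exists_tsum_hardySum_le {p q : ℝ} (hpq : p.HolderConjugate q) :
    ∃ A : ℝ, 0 < A ∧ ∀ w : ℕ → ℝ, (∀ k, 0 ≤ w k) →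
      ∑' m : ℕ, ENNReal.ofReal (1 / (m : ℝ) ^ 2) * hardySum w m ^ q ≤
        ENNReal.ofReal A * energy p q w := by
  have hp := hpq.pos
  have hq := hpq.symm.pos
  set c := min (1 / p) (1 / q) with hc
  have hc0 : 0 < c := lt_min (by positivity) (by positivity)
  have hc1 : c ≤ 1 := (min_le_left _ _).trans ((div_le_one hp).2 hpq.lt.le)
  refine ⟨(2 / c) ^ q, by positivity, fun w hw => ?_⟩
  have hS := tsum_rpow_le_of_symm hpq.symm.lt.le
    (fun m k : ℕ => ENNReal.ofReal (ratioKernel c m k)) (fun k => ENNReal.ofReal (1 / k))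
    (fun k => ENNReal.ofReal (w k * (k : ℝ) ^ (1 / p))) (ENNReal.ofReal (2 / c)) ENNReal.ofReal_ne_top
    (fun m k => by rw [ratioKernel_comm]) (fun m hm => by
      refine tsum_ratioKernel_le hc0 hc1 ?_
      rcases Nat.eq_zero_or_pos m with rfl | h
      · simp at hm
      · exact h)
  rw [← ENNReal.ofReal_rpow_of_nonneg (by positivity) hq.le]
  refine le_trans (ENNReal.tsum_le_tsum fun m => ?_) hS
  rcases Nat.eq_zero_or_pos m with rfl | hm
  · simp
  have hm0 : (0 : ℝ) < m := by exact_mod_cast hm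
  -- The weight `1/m²` splits into the Schur measure `1/m` and a factor that moves inside the `q`-th
  -- power.
  have e : ENNReal.ofReal (1 / (m : ℝ) ^ 2) =
      ENNReal.ofReal (1 / m) * ENNReal.ofReal ((m : ℝ) ^ (-(1 / q))) ^ q := by
    rw [ENNReal.ofReal_rpow_of_nonneg (by positivity) hq.le, ← Real.rpow_mul hm0.le,
      ← ENNReal.ofReal_mul (by positivity)]
    congr 1
    rw [neg_mul, one_div_mul_cancel hq.ne', Real.rpow_neg_one]; field_simp
  rw [e, mul_assoc, ← ENNReal.mul_rpow_of_nonneg _ _ hq.le, hardySum, ← ENNReal.tsum_mul_left]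
  gcongr ENNReal.ofReal _ * ?_ ^ q
  refine ENNReal.tsum_le_tsum fun k => ?_
  rw [← ENNReal.ofReal_mul (by positivity), ← ENNReal.ofReal_mul (ratioKernel_nonneg _ _ _),
    ← ENNReal.ofReal_mul (mul_nonneg (ratioKernel_nonneg _ _ _) (by positivity))]
  exact ENNReal.ofReal_le_ofReal (rpow_mul_min_le hpq (min_le_left _ _) (min_le_right _ _) hm (hw k))

/-- A profile with power decay on both sides of its peak `n` has energy comparable to the `q`-th
power of its height. Raising to the power `q ≥ 1` only improves the decay; `min c 1` meets the
restriction on the exponent in `tsum_ratioKernel_le`. -/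
theorem energy_le_of_le_ratioKernel {p q : ℝ} (hpq : p.HolderConjugate q) {c : ℝ} (hc : 0 < c)
    {w : ℕ → ℝ} {X : ℝ} {n : ℕ} (hn : 1 ≤ n) (hX : 0 ≤ X)
    (h : ∀ k : ℕ, 1 ≤ k → w k * (k : ℝ) ^ (1 / p) ≤ X * ratioKernel c n k) :
    energy p q w ≤ ENNReal.ofReal X ^ q * ENNReal.ofReal (2 / min c 1) := by
  have hq := hpq.symm.pos
  have hn0 : (0 : ℝ) < n := by exact_mod_cast hn
  refine le_trans ?_ (mul_le_mul_right (tsum_ratioKernel_le (lt_min hc one_pos) (min_le_right c 1) hn) _)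
  rw [energy, ← ENNReal.tsum_mul_left]
  refine ENNReal.tsum_le_tsum fun k => ?_
  rcases Nat.eq_zero_or_pos k with rfl | hk
  · simp
  have hk0 : (0 : ℝ) < k := by exact_mod_cast hk
  rw [mul_comm (ENNReal.ofReal (1 / (k : ℝ))), ← mul_assoc]
  gcongr
  calc ENNReal.ofReal (w k * (k : ℝ) ^ (1 / p)) ^ q
      ≤ ENNReal.ofReal (X * ratioKernel c n k) ^ q := by
        gcongr ENNReal.ofReal ?_ ^ q; exact h k hk
    _ = ENNReal.ofReal X ^ q * ENNReal.ofReal (ratioKernel c n k ^ q) := by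
      rw [ENNReal.ofReal_mul hX, ENNReal.mul_rpow_of_nonneg _ _ hq.le,
        ENNReal.ofReal_rpow_of_nonneg (ratioKernel_nonneg _ _ _) hq.le]
    _ ≤ _ := by
      gcongr
      have hb : (0 : ℝ) < (min n k : ℕ) := by exact_mod_cast lt_min hn hk
      have hb' : (0 : ℝ) < (max n k : ℕ) := by exact_mod_cast lt_of_lt_of_le hn (le_max_left _ _)
      rw [ratioKernel, ratioKernel, ← Real.rpow_mul (by positivity)]
      refine Real.rpow_le_rpow_of_exponent_ge (by positivity) ((div_le_one hb').2 ?_) ?_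
      · exact_mod_cast (min_le_left _ _).trans (le_max_left _ _)
      · exact (min_le_left _ _).trans (le_mul_of_one_le_right hc.le hpq.symm.lt.le)

/-! ### Summation by parts for cosine sums with regular coefficients -/

/-- The partial sums of `∑ w k * cos (k u - γ)`. -/
noncomputable def cosSum (w : ℕ → ℝ) (γ : ℝ) (N : ℕ) (u : ℝ) : ℝ :=
  ∑ k ∈ Finset.Ico 1 N, w k * Real.cos (k * u - γ)

/-- Nonnegative sequences that grow at most polynomially, tend to zero, and satisfy
`∑ w k / k < ∞`. -/
structure Regular (C : ℝ) (w : ℕ → ℝ) : Prop where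
  const_nonneg : 0 ≤ C
  nonneg : ∀ k, 0 ≤ w k
  growth : ∀ k : ℕ, 1 ≤ k → w (k + 1) ≤ (1 + C / k) * w k
  tendsto : Tendsto w atTop (𝓝 0)
  summable : Summable fun k : ℕ => w k / k

namespace Regular
variable {C : ℝ} {w : ℕ → ℝ}

/-- Since `|x| = 2x⁺ - x`, total variation is twice the upward variation minus the net change, and
the growth condition bounds each upward jump by `C * (w k / k)`. -/
theorem sum_abs_sub_le (h : Regular C w) {a b : ℕ} (ha : 1 ≤ a) (hab : a ≤ b) :
    w b + ∑ k ∈ Finset.Ico a b, |w (k + 1) - w k| ≤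
      w a + 2 * C * ∑ k ∈ Finset.Ico a b, w k / k := by
  induction b, hab using Nat.le_induction with
  | base => simp
  | succ b hab ih =>
    rw [Finset.sum_Ico_succ_top hab, Finset.sum_Ico_succ_top hab]
    have hb : (0 : ℝ) < b := by exact_mod_cast (by omega : 0 < b)
    have h1 := h.growth b (by omega)
    have h2 : (1 + C / b) * w b = w b + C * (w b / b) := by ring
    have h3 : 0 ≤ C * (w b / b) := mul_nonneg h.const_nonneg (div_nonneg (h.nonneg b) hb.le)
    have h4 : |w (b + 1) - w b| ≤ 2 * (C * (w b / b)) - (w (b + 1) - w b) := by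
      rw [abs_le]; constructor <;> linarith
    linarith

theorem norm_sum_mul_pow_le (h : Regular C w) {a b : ℕ} (ha : 1 ≤ a) (hab : a ≤ b) {z : ℂ}
    (hz : ‖z‖ = 1) :
    ‖z - 1‖ * ‖∑ k ∈ Finset.Ico a b, (w k : ℂ) * z ^ k‖ ≤
      2 * w a + 2 * C * ∑ k ∈ Finset.Ico a b, w k / k := by
  have e : (z - 1) * ∑ k ∈ Finset.Ico a b, (w k : ℂ) * z ^ k =
      w b * z ^ b - w a * z ^ a - ∑ k ∈ Finset.Ico a b, ((w (k + 1) - w k : ℝ) : ℂ) * z ^ (k + 1) := by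
    induction b, hab using Nat.le_induction with
    | base => simp
    | succ b hab ih =>
      rw [Finset.sum_Ico_succ_top hab, Finset.sum_Ico_succ_top hab, mul_add, ih]
      push_cast; ring
  rw [← norm_mul, e]
  have h1 : ‖∑ k ∈ Finset.Ico a b, ((w (k + 1) - w k : ℝ) : ℂ) * z ^ (k + 1)‖ ≤
      ∑ k ∈ Finset.Ico a b, |w (k + 1) - w k| := by
    refine (norm_sum_le _ _).trans (le_of_eq (Finset.sum_congr rfl fun k _ => ?_))
    rw [norm_mul, norm_pow, hz, one_pow, mul_one, Complex.norm_real, Real.norm_eq_abs]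
  have h2 : ∀ k, ‖(w k : ℂ) * z ^ k‖ = w k := fun k => by
    rw [norm_mul, norm_pow, hz, one_pow, mul_one, Complex.norm_real, Real.norm_eq_abs,
      abs_of_nonneg (h.nonneg k)]
  have h3 := h.sum_abs_sub_le ha hab
  calc _ ≤ ‖(w b : ℂ) * z ^ b‖ + ‖(w a : ℂ) * z ^ a‖ + _ :=
        (norm_sub_le _ _).trans (add_le_add_left (norm_sub_le _ _) _)
    _ ≤ _ := by rw [h2, h2]; linarith

end Regular

/-- The phase is a rotation of the complex sum, so it disappears from the bound. This is the source
of uniformity in `β`. -/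
theorem abs_sum_cos_le_norm (w : ℕ → ℝ) (s : Finset ℕ) (γ u : ℝ) :
    |∑ k ∈ s, w k * Real.cos (k * u - γ)| ≤
      ‖∑ k ∈ s, (w k : ℂ) * Complex.exp (Complex.I * u) ^ k‖ := by
  have e : ∑ k ∈ s, w k * Real.cos (k * u - γ) =
      (Complex.exp (-γ * Complex.I) * ∑ k ∈ s, (w k : ℂ) * Complex.exp (Complex.I * u) ^ k).re := by
    rw [Finset.mul_sum, Complex.re_sum]
    refine Finset.sum_congr rfl fun k _ => ?_
    rw [mul_left_comm, ← Complex.exp_nat_mul, ← Complex.exp_add, Complex.re_ofReal_mul,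
      show -(γ : ℂ) * Complex.I + k * (Complex.I * u) = ((k * u - γ : ℝ) : ℂ) * Complex.I by
        push_cast; ring, Complex.exp_ofReal_mul_I_re]
  rw [e]
  refine (Complex.abs_re_le_norm _).trans (le_of_eq ?_)
  rw [norm_mul, ← Complex.ofReal_neg, Complex.norm_exp_ofReal_mul_I, one_mul]

theorem le_norm_exp_sub_one {u : ℝ} (hu : |u| ≤ π) :
    2 / π * |u| ≤ ‖Complex.exp (Complex.I * u) - 1‖ := by
  rw [Complex.norm_exp_I_mul_ofReal_sub_one, norm_mul, Real.norm_eq_abs, Real.norm_eq_abs,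
    abs_of_pos (by norm_num : (0 : ℝ) < 2)]
  have h := Real.mul_abs_le_abs_sin (x := u / 2) (by rw [abs_div, abs_two]; linarith)
  rw [abs_div, abs_two] at h
  calc 2 / π * |u| = 2 * (2 / π * (|u| / 2)) := by ring
    _ ≤ _ := by gcongr

namespace Regular
variable {C : ℝ} {w : ℕ → ℝ}

theorem abs_sum_cos_le (h : Regular C w) {a b m : ℕ} (ha : 1 ≤ a) (hab : a ≤ b) {u : ℝ} (γ : ℝ)
    (hm : π / (m + 1) ≤ |u|) (hu : |u| ≤ π) :
    |∑ k ∈ Finset.Ico a b, w k * Real.cos (k * u - γ)| ≤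
      (m + 1) * (w a + C * ∑ k ∈ Finset.Ico a b, w k / k) := by
  refine (abs_sum_cos_le_norm w _ γ u).trans ?_
  have h1 := h.norm_sum_mul_pow_le ha hab (z := Complex.exp (Complex.I * u))
    (by rw [mul_comm, Complex.norm_exp_ofReal_mul_I])
  have h2 : 2 / (m + 1) ≤ ‖Complex.exp (Complex.I * u) - 1‖ :=
    calc (2 : ℝ) / (m + 1) = 2 / π * (π / (m + 1)) := by field_simp
      _ ≤ 2 / π * |u| := by gcongr
      _ ≤ _ := le_norm_exp_sub_one hu
  set B := ‖∑ k ∈ Finset.Ico a b, (w k : ℂ) * Complex.exp (Complex.I * u) ^ k‖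
  have h3 : 2 / (m + 1) * B ≤ 2 * w a + 2 * C * ∑ k ∈ Finset.Ico a b, w k / k :=
    le_trans (by gcongr) h1
  have hm1 : (0 : ℝ) < m + 1 := by positivity
  calc B = (m + 1) / 2 * (2 / (m + 1) * B) := by field_simp
    _ ≤ (m + 1) / 2 * (2 * w a + 2 * C * ∑ k ∈ Finset.Ico a b, w k / k) := by gcongr
    _ = _ := by ring

/-- Telescoping: each increment of `k * w k` is at most `w (k + 1) + C * w k`. -/
theorem mul_self_le (h : Regular C w) {m : ℕ} (hm : 1 ≤ m) :
    m * w m ≤ (1 + C) * ∑ k ∈ Finset.Ico 1 (m + 1), w k := by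
  have hC := h.const_nonneg
  have key : m * w m ≤ ∑ k ∈ Finset.Ico 1 (m + 1), w k + C * ∑ k ∈ Finset.Ico 1 m, w k := by
    induction m, hm using Nat.le_induction with
    | base => simp
    | succ m hm ih =>
      rw [Finset.sum_Ico_succ_top (by omega : 1 ≤ m + 1), Finset.sum_Ico_succ_top hm] at *
      have hm0 : (1 : ℝ) ≤ m := by exact_mod_cast hm
      have h1 := h.growth m hm
      have h2 : (m : ℝ) * w (m + 1) ≤ m * w m + C * w m := by
        calc (m : ℝ) * w (m + 1) ≤ m * ((1 + C / m) * w m) := by gcongr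
          _ = _ := by field_simp
      push_cast
      linarith
  have : ∑ k ∈ Finset.Ico 1 m, w k ≤ ∑ k ∈ Finset.Ico 1 (m + 1), w k :=
    Finset.sum_le_sum_of_subset_of_nonneg (Finset.Ico_subset_Ico_right (by omega))
      fun k _ _ => h.nonneg k
  nlinarith

/-- Indices below `m` are estimated trivially, those from `m` on by summation by parts. The constant
comes from `G + 2(1 + C)G + 2CG`. -/
theorem abs_cosSum_le (h : Regular C w) {m : ℕ} (hm : 1 ≤ m) (N : ℕ) {u : ℝ} (γ : ℝ)
    (hmu : π / (m + 1) ≤ |u|) (hu : |u| ≤ π) :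
    |cosSum w γ N u| ≤
      (3 + 4 * C) * ∑ k ∈ Finset.Ico 1 (max N (m + 1)), min 1 ((m : ℝ) / k) * w k := by
  have hC := h.const_nonneg
  have hm0 : (1 : ℝ) ≤ m := by exact_mod_cast hm
  -- The upper limit is at least `m + 1`, so that `G` contains all of `w 1, ..., w m` even when `N`
  -- is small.
  set G := ∑ k ∈ Finset.Ico 1 (max N (m + 1)), min 1 ((m : ℝ) / k) * w k with hG
  have hnn : ∀ k : ℕ, 0 ≤ min 1 ((m : ℝ) / k) * w k := fun k =>
    mul_nonneg (le_min zero_le_one (by positivity)) (h.nonneg k)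
  have hsub : ∀ a b, 1 ≤ a → b ≤ max N (m + 1) →
      ∑ k ∈ Finset.Ico a b, min 1 ((m : ℝ) / (k : ℕ)) * w k ≤ G := fun a b ha hb =>
    Finset.sum_le_sum_of_subset_of_nonneg (Finset.Ico_subset_Ico ha hb) fun k _ _ => hnn k
  have hlow : ∀ b, b ≤ m + 1 → ∑ k ∈ Finset.Ico 1 b, w k ≤ G := fun b hb => by
    refine le_trans (le_of_eq (Finset.sum_congr rfl fun (k : ℕ) hk => ?_))
      (hsub 1 b le_rfl (hb.trans (le_max_right _ _)))
    rw [Finset.mem_Ico] at hk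
    have hk0 : (0 : ℝ) < k := by exact_mod_cast hk.1
    rw [min_eq_left, one_mul]
    rw [one_le_div hk0]; exact_mod_cast (by omega : k ≤ m)
  have hG0 : 0 ≤ G := Finset.sum_nonneg fun k _ => hnn k
  rcases le_total N m with hN | hN
  · calc |cosSum w γ N u| ≤ ∑ k ∈ Finset.Ico 1 N, w k := by
          refine (Finset.abs_sum_le_sum_abs _ _).trans (Finset.sum_le_sum fun k _ => ?_)
          rw [abs_mul, abs_of_nonneg (h.nonneg k)]
          exact mul_le_of_le_one_right (h.nonneg k) (Real.abs_cos_le_one _)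
      _ ≤ G := hlow N (by omega)
      _ ≤ _ := le_mul_of_one_le_left hG0 (by linarith)
  · have hhigh : m * ∑ k ∈ Finset.Ico m N, w k / k ≤ G := by
      refine le_trans (le_of_eq ?_) (hsub m N hm (le_max_left _ _))
      rw [Finset.mul_sum]
      refine Finset.sum_congr rfl fun k hk => ?_
      rw [Finset.mem_Ico] at hk
      have hk0 : (0 : ℝ) < k := by exact_mod_cast (by omega : 0 < k)
      rw [min_eq_right]
      · ring
      · rw [div_le_one hk0]; exact_mod_cast hk.1
    have h1 := h.abs_sum_cos_le hm hN γ hmu hu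
    have h2 : |∑ k ∈ Finset.Ico 1 m, w k * Real.cos (k * u - γ)| ≤ G := by
      refine le_trans ?_ (hlow m (by omega))
      refine (Finset.abs_sum_le_sum_abs _ _).trans (Finset.sum_le_sum fun k _ => ?_)
      rw [abs_mul, abs_of_nonneg (h.nonneg k)]
      exact mul_le_of_le_one_right (h.nonneg k) (Real.abs_cos_le_one _)
    have h3 : m * w m ≤ (1 + C) * G := (h.mul_self_le hm).trans (by gcongr; exact hlow _ le_rfl)
    have h4 : 0 ≤ ∑ k ∈ Finset.Ico m N, w k / k :=
      Finset.sum_nonneg fun k _ => div_nonneg (h.nonneg k) k.cast_nonneg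
    rw [cosSum, ← Finset.sum_Ico_consecutive _ hm hN]
    refine (abs_add_le _ _).trans ((add_le_add h2 h1).trans ?_)
    set R := ∑ k ∈ Finset.Ico m N, w k / k
    have h5 : ((m : ℝ) + 1) * (w m + C * R) ≤ (2 * m) * (w m + C * R) := by
      have : 0 ≤ w m + C * R := add_nonneg (h.nonneg m) (mul_nonneg hC h4)
      gcongr; linarith
    have h6 : C * (m * R) ≤ C * G := by gcongr
    linarith

theorem ofReal_abs_cosSum_le (h : Regular C w) {m : ℕ} (hm : 1 ≤ m) (N : ℕ) {u : ℝ} (γ : ℝ)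
    (hmu : π / (m + 1) ≤ |u|) (hu : |u| ≤ π) :
    ENNReal.ofReal |cosSum w γ N u| ≤ ENNReal.ofReal (3 + 4 * C) * hardySum w m := by
  refine (ENNReal.ofReal_le_ofReal (h.abs_cosSum_le hm N γ hmu hu)).trans ?_
  rw [ENNReal.ofReal_mul (by linarith [h.const_nonneg]), ENNReal.ofReal_sum_of_nonneg fun k _ =>
    mul_nonneg (le_min zero_le_one (by positivity)) (h.nonneg k)]
  gcongr
  exact ENNReal.sum_le_tsum _

end Regular

/-! ### The sum of the cosine series and its `L_q` norm -/

/-- The sum of the series `∑ w k * cos (k u - γ)`. -/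
noncomputable def cosSeries (w : ℕ → ℝ) (γ : ℝ) (u : ℝ) : ℝ :=
  limUnder atTop fun N => cosSum w γ N u

theorem cosSum_periodic (w : ℕ → ℝ) (γ : ℝ) (N : ℕ) : Function.Periodic (cosSum w γ N) (2 * π) := by
  intro u
  refine Finset.sum_congr rfl fun k _ => ?_
  rw [show (k : ℝ) * (u + 2 * π) - γ = k * u - γ + k * (2 * π) by ring, Real.cos_add_nat_mul_two_pi]

theorem cosSeries_periodic (w : ℕ → ℝ) (γ : ℝ) : Function.Periodic (cosSeries w γ) (2 * π) := by
  intro u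
  simp only [cosSeries, cosSum_periodic w γ _ u]

theorem exists_pi_div_le {u : ℝ} (hu0 : u ≠ 0) (hu : |u| ≤ π) :
    1 ≤ ⌊π / |u|⌋₊ ∧ π / (⌊π / |u|⌋₊ + 1) < |u| ∧ |u| ≤ π / ⌊π / |u|⌋₊ := by
  have h0 : 0 < |u| := abs_pos.2 hu0
  have h1 : 1 ≤ π / |u| := (one_le_div h0).2 hu
  have h2 : 1 ≤ ⌊π / |u|⌋₊ := Nat.le_floor (by exact_mod_cast h1)
  have h3 : (0 : ℝ) < ⌊π / |u|⌋₊ := by exact_mod_cast h2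
  refine ⟨h2, ?_, ?_⟩
  · rw [div_lt_iff₀ (by positivity), mul_comm, ← div_lt_iff₀ h0]
    exact Nat.lt_floor_add_one _
  · rw [le_div_iff₀ h3, mul_comm, ← le_div_iff₀ h0]
    exact Nat.floor_le (by positivity)

/-- The block estimate at a fixed `u ≠ 0` is a multiple of `w N` plus a tail of `∑ w k / k`, and
both tend to zero, so the partial sums are Cauchy. -/
theorem Regular.tendsto_cosSum {C : ℝ} {w : ℕ → ℝ} (h : Regular C w) (γ : ℝ) {u : ℝ} (hu0 : u ≠ 0)
    (hu : |u| ≤ π) : Tendsto (fun N => cosSum w γ N u) atTop (𝓝 (cosSeries w γ u)) := by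
  refine CauchySeq.tendsto_limUnder (Metric.cauchySeq_iff'.2 fun ε hε => ?_)
  obtain ⟨_, hm, _⟩ := exists_pi_div_le hu0 hu
  set m := ⌊π / |u|⌋₊
  have ht : Tendsto (fun N : ℕ => ((m : ℝ) + 1) * (w N + C * ∑' k, w (k + N) / (k + N : ℕ)))
      atTop (𝓝 0) := by
    have := (h.tendsto.add ((tendsto_sum_nat_add fun k : ℕ => w k / k).const_mul C)).const_mul
      ((m : ℝ) + 1)
    simpa using this
  obtain ⟨N, hN, hN1⟩ := ((ht.eventually (gt_mem_nhds hε)).and (eventually_ge_atTop 1)).exists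
  refine ⟨N, fun n hn => lt_of_le_of_lt ?_ hN⟩
  rw [Real.dist_eq, cosSum, cosSum, ← Finset.sum_Ico_consecutive _ hN1 hn, add_sub_cancel_left]
  refine (h.abs_sum_cos_le hN1 hn γ hm.le hu).trans ?_
  have hC := h.const_nonneg
  gcongr
  rw [Finset.sum_Ico_eq_sum_range]
  simp_rw [add_comm N]
  exact ((summable_nat_add_iff N).2 h.summable).sum_le_tsum _
    fun k _ => div_nonneg (h.nonneg _) (Nat.cast_nonneg _)

theorem Regular.ofReal_abs_cosSeries_le {C : ℝ} {w : ℕ → ℝ} (h : Regular C w) {m : ℕ} (hm : 1 ≤ m)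
    {u : ℝ} (γ : ℝ) (hmu : π / (m + 1) ≤ |u|) (hu : |u| ≤ π) :
    ENNReal.ofReal |cosSeries w γ u| ≤ ENNReal.ofReal (3 + 4 * C) * hardySum w m := by
  have h0 : 0 < |u| := lt_of_lt_of_le (by positivity) hmu
  exact le_of_tendsto (ENNReal.tendsto_ofReal (h.tendsto_cosSum γ (abs_pos.1 h0) hu).abs)
    (Eventually.of_forall fun N => h.ofReal_abs_cosSum_le hm N γ hmu hu)

/-- The two-sided shell with index `m` has measure `2π/(m(m+1)) ≤ 2π/m²`, and the shells cover the
period up to the null set `{0}`. -/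
theorem lintegral_le_tsum_shell {F : ℝ → ℝ≥0∞} {B : ℕ → ℝ≥0∞}
    (hF : ∀ m : ℕ, 1 ≤ m → ∀ u : ℝ, π / (m + 1) < |u| → |u| ≤ π / m → F u ≤ B m) :
    ∫⁻ u, F u ∂periodMeasure ≤
      ENNReal.ofReal (2 * π) * ∑' m : ℕ, ENNReal.ofReal (1 / (m : ℝ) ^ 2) * B m := by
  let s : ℕ → Set ℝ := fun m => {u | 1 ≤ m ∧ π / (m + 1) < |u| ∧ |u| ≤ π / m}
  have hvol : ∀ m, volume (s m) ≤ ENNReal.ofReal (2 * π) * ENNReal.ofReal (1 / (m : ℝ) ^ 2) := by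
    intro m
    by_cases hm : 1 ≤ m
    · have hm0 : (0 : ℝ) < m := by exact_mod_cast hm
      have hsub : s m ⊆ Icc (π / (m + 1)) (π / m) ∪ Icc (-(π / m)) (-(π / (m + 1))) := by
        rintro u ⟨-, h1, h2⟩
        rcases abs_cases u with ⟨h3, _⟩ | ⟨h3, _⟩
        · left; rw [h3] at h1 h2; exact ⟨h1.le, h2⟩
        · right; rw [h3] at h1 h2; exact ⟨by linarith, by linarith⟩
      have hd : 0 ≤ π / m - π / (m + 1) := by
        rw [sub_nonneg]; gcongr; linarith
      calc volume (s m) ≤ _ := measure_mono hsub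
        _ ≤ _ := measure_union_le _ _
        _ = ENNReal.ofReal (2 * (π / m - π / (m + 1))) := by
          rw [Real.volume_Icc, Real.volume_Icc, ← ENNReal.ofReal_add hd (by linarith)]
          congr 1; ring
        _ ≤ ENNReal.ofReal (2 * π * (1 / (m : ℝ) ^ 2)) := by
          refine ENNReal.ofReal_le_ofReal ?_
          have : π / m - π / (m + 1) = π / (m * (m + 1)) := by field_simp; ring
          rw [this, mul_one_div, mul_div_assoc]
          gcongr
          nlinarith
        _ = _ := ENNReal.ofReal_mul (by positivity)
    · have : s m = ∅ := by ext u; simp [s, hm]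
      rw [this]; simp
  have hcov : (Ioc (-π) π : Set ℝ) ≤ᵐ[volume] (⋃ m, s m : Set ℝ) := by
    have h0 : ∀ᵐ u : ℝ, u ≠ 0 := by
      simp [ae_iff]
    filter_upwards [h0] with u hu0 hu
    have hu' : |u| ≤ π := abs_le.2 ⟨hu.1.le, hu.2⟩
    exact mem_iUnion.2 ⟨_, exists_pi_div_le hu0 hu'⟩
  calc ∫⁻ u, F u ∂periodMeasure ≤ ∫⁻ u in ⋃ m, s m, F u :=
        lintegral_mono' (Measure.restrict_mono' hcov le_rfl) le_rfl
    _ ≤ ∑' m, ∫⁻ u in s m, F u := lintegral_iUnion_le _ _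
    _ ≤ ∑' m : ℕ, ENNReal.ofReal (2 * π) * (ENNReal.ofReal (1 / (m : ℝ) ^ 2) * B m) := by
        refine ENNReal.tsum_le_tsum fun m => ?_
        have hms : MeasurableSet (s m) := by
          simp only [s]
          exact (MeasurableSet.const _).inter ((measurableSet_lt measurable_const measurable_norm).inter
            (measurableSet_le measurable_norm measurable_const))
        calc ∫⁻ u in s m, F u ≤ ∫⁻ _ in s m, B m :=
              setLIntegral_mono' hms fun u hu => hF m hu.1 u hu.2.1 hu.2.2
          _ = B m * volume (s m) := by rw [setLIntegral_const]
          _ ≤ B m * (ENNReal.ofReal (2 * π) * ENNReal.ofReal (1 / (m : ℝ) ^ 2)) := by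
            gcongr; exact hvol m
          _ = _ := by ring
    _ = _ := ENNReal.tsum_mul_left

/-- The Hardy–Littlewood inequality. The constant is fixed before `w` and `γ`, which later gives
independence of `n` and `β`. -/
theorem Regular.exists_lintegral_cosSeries_le {p q : ℝ} (hpq : p.HolderConjugate q) (C : ℝ) :
    ∃ K : ℝ, 0 < K ∧ ∀ w : ℕ → ℝ, Regular C w → ∀ γ : ℝ,
      ∫⁻ u, ENNReal.ofReal |cosSeries w γ u| ^ q ∂periodMeasure ≤ ENNReal.ofReal K * energy p q w := by
  obtain ⟨A, hA, hAw⟩ := exists_tsum_hardySum_le hpq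
  have hq := hpq.symm.pos
  -- The sign of `C` is not known until a regular sequence is given, hence the absolute value.
  refine ⟨2 * π * (|3 + 4 * C| + 1) ^ q * A, by positivity, fun w h γ => ?_⟩
  have hC := h.const_nonneg
  refine (lintegral_le_tsum_shell (B := fun m => (ENNReal.ofReal (|3 + 4 * C| + 1) * hardySum w m) ^ q)
    fun m hm u h1 h2 => ?_).trans ?_
  · gcongr
    have hm1 : (1 : ℝ) ≤ m := by exact_mod_cast hm
    refine (h.ofReal_abs_cosSeries_le hm γ h1.le (h2.trans (div_le_self Real.pi_nonneg hm1))).trans ?_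
    gcongr ENNReal.ofReal ?_ * _
    linarith [le_abs_self (3 + 4 * C)]
  · simp_rw [ENNReal.mul_rpow_of_nonneg _ _ hq.le, mul_left_comm _ (ENNReal.ofReal _ ^ q)]
    rw [ENNReal.tsum_mul_left, ENNReal.ofReal_mul (p := 2 * π * _) (by positivity),
      ENNReal.ofReal_mul (p := 2 * π) (by positivity),
      ENNReal.ofReal_rpow_of_nonneg (by positivity) hq.le, mul_assoc, mul_assoc]
    gcongr ENNReal.ofReal _ * (ENNReal.ofReal _ * ?_)
    exact hAw w h.nonneg

instance : IsFiniteMeasure periodMeasure := by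
  unfold periodMeasure; infer_instance

theorem ae_periodMeasure : ∀ᵐ u ∂periodMeasure, u ≠ 0 ∧ |u| ≤ π := by
  have h0 : ∀ᵐ u ∂periodMeasure, u ≠ 0 := by
    refine ae_restrict_of_ae ?_
    simp [ae_iff]
  have h1 : ∀ᵐ u ∂periodMeasure, u ∈ Ioc (-π) π := ae_restrict_mem measurableSet_Ioc
  filter_upwards [h0, h1] with u hu0 hu
  exact ⟨hu0, abs_le.2 ⟨hu.1.le, hu.2⟩⟩

/-- The shell bound does not depend on `N`, so it serves as a majorant for dominated convergence; it
is integrable because `x ≤ 1 + x^q`. -/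
theorem Regular.exists_integrable_bound {p q : ℝ} (hpq : p.HolderConjugate q) {C : ℝ} {w : ℕ → ℝ}
    (h : Regular C w) (hE : energy p q w ≠ ⊤) (γ : ℝ) :
    ∃ M : ℝ → ℝ, Integrable M periodMeasure ∧
      ∀ N, ∀ᵐ u ∂periodMeasure, ‖cosSum w γ N u‖ ≤ M u := by
  obtain ⟨A, hA, hAw⟩ := exists_tsum_hardySum_le hpq
  have hq := hpq.symm.pos
  have hfin : ∑' m : ℕ, ENNReal.ofReal (1 / (m : ℝ) ^ 2) * hardySum w m ^ q ≠ ⊤ :=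
    ne_top_of_le_ne_top (ENNReal.mul_ne_top ENNReal.ofReal_ne_top hE) (hAw w h.nonneg)
  have hH : ∀ m : ℕ, 1 ≤ m → hardySum w m ≠ ⊤ := fun m hm htop => by
    have h1 := ENNReal.ne_top_of_tsum_ne_top hfin m
    have hm0 : (0 : ℝ) < m := by exact_mod_cast hm
    rw [htop, ENNReal.top_rpow_of_pos hq, ENNReal.mul_top] at h1
    · exact h1 rfl
    · simp; positivity
  let M : ℝ → ℝ≥0∞ := fun u => ENNReal.ofReal (3 + 4 * C) * hardySum w ⌊π / |u|⌋₊
  have hMmeas : Measurable M := by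
    have : Measurable fun u : ℝ => ⌊π / |u|⌋₊ :=
      Nat.measurable_floor.comp (measurable_const.div measurable_norm)
    exact measurable_const.mul ((measurable_from_nat (f := hardySum w)).comp this)
  have hMint : ∫⁻ u, M u ∂periodMeasure ≠ ⊤ := by
    refine ne_top_of_le_ne_top ?_ (lintegral_le_tsum_shell
      (B := fun m => ENNReal.ofReal (3 + 4 * C) * (1 + hardySum w m ^ q)) fun m hm u h1 h2 => ?_)
    · refine ENNReal.mul_ne_top ENNReal.ofReal_ne_top ?_
      simp_rw [mul_left_comm _ (ENNReal.ofReal (3 + 4 * C))]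
      rw [ENNReal.tsum_mul_left]
      simp_rw [mul_add, mul_one]
      rw [ENNReal.tsum_add]
      refine ENNReal.mul_ne_top ENNReal.ofReal_ne_top (ENNReal.add_ne_top.2 ⟨?_, hfin⟩)
      exact (Real.summable_one_div_nat_pow.2 one_lt_two).tsum_ofReal_ne_top
    · have hm0 : (0 : ℝ) < m := by exact_mod_cast hm
      have hu : 0 < |u| := lt_trans (by positivity) h1
      have hfl : ⌊π / |u|⌋₊ = m := by
        rw [Nat.floor_eq_iff (by positivity), le_div_iff₀ hu, div_lt_iff₀ hu]
        rw [div_lt_iff₀ (by positivity)] at h1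
        rw [le_div_iff₀ hm0] at h2
        constructor <;> linarith
      simp only [M, hfl]
      gcongr
      rcases le_total (hardySum w m) 1 with h3 | h3
      · exact h3.trans le_self_add
      · refine le_trans ?_ le_add_self
        conv_lhs => rw [← ENNReal.rpow_one (hardySum w m)]
        exact ENNReal.rpow_le_rpow_of_exponent_le h3 hpq.symm.lt.le
  refine ⟨fun u => (M u).toReal, integrable_toReal_of_lintegral_ne_top hMmeas.aemeasurable hMint,
    fun N => ?_⟩
  filter_upwards [ae_periodMeasure] with u hu
  obtain ⟨hm, h1, h2⟩ := exists_pi_div_le hu.1 hu.2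
  rw [Real.norm_eq_abs, ← ENNReal.toReal_ofReal (abs_nonneg (cosSum w γ N u))]
  exact ENNReal.toReal_mono (ENNReal.mul_ne_top ENNReal.ofReal_ne_top (hH _ hm))
    (h.ofReal_abs_cosSum_le hm N γ h1.le hu.2)

theorem continuous_cosSum (w : ℕ → ℝ) (γ : ℝ) (N : ℕ) : Continuous (cosSum w γ N) := by
  unfold cosSum; fun_prop

theorem Regular.aestronglyMeasurable_cosSeries {C : ℝ} {w : ℕ → ℝ} (h : Regular C w) (γ : ℝ) :
    AEStronglyMeasurable (cosSeries w γ) periodMeasure := by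
  refine aestronglyMeasurable_of_tendsto_ae atTop
    (fun N => (continuous_cosSum w γ N).aestronglyMeasurable) ?_
  filter_upwards [ae_periodMeasure] with u hu using h.tendsto_cosSum γ hu.1 hu.2

theorem Regular.memLp_cosSeries {p q : ℝ} (hpq : p.HolderConjugate q) {C : ℝ} {w : ℕ → ℝ}
    (h : Regular C w) (hE : energy p q w ≠ ⊤) (γ : ℝ) :
    MemLp (cosSeries w γ) (ENNReal.ofReal q) periodMeasure := by
  have hq := hpq.symm.pos
  obtain ⟨K, -, hK⟩ := Regular.exists_lintegral_cosSeries_le hpq C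
  refine ⟨h.aestronglyMeasurable_cosSeries γ, ?_⟩
  rw [eLpNorm_lt_top_iff_lintegral_rpow_enorm_lt_top (by simpa using hq) ENNReal.ofReal_ne_top,
    ENNReal.toReal_ofReal hq.le]
  simp_rw [Real.enorm_eq_ofReal_abs]
  exact (hK w h γ).trans_lt (ENNReal.mul_lt_top ENNReal.ofReal_lt_top hE.lt_top)

/-! ### Fourier coefficients of the sum of the series -/

theorem integral_cos_int_mul_sub {l : ℤ} (hl : l ≠ 0) (γ : ℝ) :
    ∫ u in (-π)..π, Real.cos (l * u - γ) = 0 := by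
  have hl' : (l : ℝ) ≠ 0 := by exact_mod_cast hl
  rw [intervalIntegral.integral_comp_mul_sub (fun x => Real.cos x) hl', integral_cos,
    show (l : ℝ) * π - γ = l * -π - γ + l * (2 * π) by ring, Real.sin_add_int_mul_two_pi]
  simp

theorem integral_cos_mul_cos {j k : ℕ} (hj : 1 ≤ j) (γ δ : ℝ) :
    ∫ u in (-π)..π, Real.cos (j * u - γ) * Real.cos (k * u - δ) =
      if j = k then π * Real.cos (γ - δ) else 0 := by
  have e : ∀ u : ℝ, Real.cos (j * u - γ) * Real.cos (k * u - δ) =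
      (1 / 2) * (Real.cos (((j + k : ℤ) : ℝ) * u - (γ + δ)) +
        Real.cos (((j - k : ℤ) : ℝ) * u - (γ - δ))) := fun u => by
    have h1 : ((j + k : ℤ) : ℝ) * u - (γ + δ) = (j * u - γ) + (k * u - δ) := by push_cast; ring
    have h2 : ((j - k : ℤ) : ℝ) * u - (γ - δ) = (j * u - γ) - (k * u - δ) := by push_cast; ring
    rw [h1, h2, Real.cos_add, Real.cos_sub (j * u - γ)]; ring
  simp_rw [e]
  rw [intervalIntegral.integral_const_mul, intervalIntegral.integral_add
    (Continuous.intervalIntegrable (by fun_prop) _ _) (Continuous.intervalIntegrable (by fun_prop) _ _),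
    integral_cos_int_mul_sub (by omega), zero_add]
  split_ifs with h
  · subst h
    simp only [sub_self, Int.cast_zero, zero_mul, zero_sub, Real.cos_neg,
      intervalIntegral.integral_const, smul_eq_mul]
    ring
  · rw [integral_cos_int_mul_sub (by omega), mul_zero]

theorem integral_cosSum_mul_cos (w : ℕ → ℝ) (γ δ : ℝ) (N k : ℕ) :
    ∫ u in (-π)..π, cosSum w γ N u * Real.cos (k * u - δ) =
      if k ∈ Finset.Ico 1 N then π * (w k * Real.cos (γ - δ)) else 0 := by
  simp_rw [cosSum, Finset.sum_mul]
  rw [intervalIntegral.integral_finsetSum fun j _ => Continuous.intervalIntegrable (by fun_prop) _ _]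
  have : ∀ j ∈ Finset.Ico 1 N, ∫ u in (-π)..π, w j * Real.cos (j * u - γ) * Real.cos (k * u - δ) =
      if j = k then π * (w k * Real.cos (γ - δ)) else 0 := fun j hj => by
    simp_rw [mul_assoc]
    rw [intervalIntegral.integral_const_mul, integral_cos_mul_cos (Finset.mem_Ico.1 hj).1]
    split_ifs with h
    · subst h; ring
    · simp
  rw [Finset.sum_congr rfl this, Finset.sum_ite_eq']

/-- For `N > k` the integral against the partial sum already has its final value, and dominated
convergence passes to the limit. The phases `δ = 0` and `δ = π/2` give the cosine and sine
coefficients. -/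
theorem Regular.integral_cosSeries_mul_cos {p q : ℝ} (hpq : p.HolderConjugate q) {C : ℝ} {w : ℕ → ℝ}
    (h : Regular C w) (hE : energy p q w ≠ ⊤) (γ δ : ℝ) (k : ℕ) :
    ∫ u in (-π)..π, cosSeries w γ u * Real.cos (k * u - δ) =
      if 1 ≤ k then π * (w k * Real.cos (γ - δ)) else 0 := by
  obtain ⟨M, hM, hMb⟩ := h.exists_integrable_bound hpq hE γ
  have hlim : Tendsto (fun N => ∫ u in (-π)..π, cosSum w γ N u * Real.cos (k * u - δ)) atTop
      (𝓝 (∫ u in (-π)..π, cosSeries w γ u * Real.cos (k * u - δ))) := by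
    simp_rw [intervalIntegral.integral_of_le (by linarith [Real.pi_pos] : -π ≤ π)]
    refine tendsto_integral_of_dominated_convergence M
      (fun N => ((continuous_cosSum w γ N).mul (by fun_prop)).aestronglyMeasurable) hM (fun N => ?_) ?_
    · filter_upwards [hMb N] with u hu
      rw [norm_mul]
      exact (mul_le_of_le_one_right (norm_nonneg _) (Real.abs_cos_le_one _)).trans hu
    · filter_upwards [ae_periodMeasure] with u hu
      exact (h.tendsto_cosSum γ hu.1 hu.2).mul_const _
  refine tendsto_nhds_unique hlim ?_
  refine tendsto_const_nhds.congr' ?_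
  filter_upwards [eventually_gt_atTop k] with N hN
  rw [integral_cosSum_mul_cos]
  simp [hN]

theorem Regular.isKernel_cosSeries {p q : ℝ} (hpq : p.HolderConjugate q) {C : ℝ} {w : ℕ → ℝ}
    (h : Regular C w) (hE : energy p q w ≠ ⊤) (β : ℝ) {ψ : ℝ → ℝ} (hψ : ∀ k : ℕ, 1 ≤ k → w k = ψ k) :
    IsKernel ψ β (cosSeries w (β * π / 2)) where
  periodic := cosSeries_periodic _ _
  integrable := (h.memLp_cosSeries hpq hE _).integrable (by simpa using hpq.symm.lt.le)
  cosCoeff_zero := by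
    have := h.integral_cosSeries_mul_cos hpq hE (β * π / 2) 0 0
    rw [cosCoeff]
    simp only [sub_zero] at this
    rw [this]; simp
  cosCoeff_eq k hk := by
    have := h.integral_cosSeries_mul_cos hpq hE (β * π / 2) 0 k
    rw [cosCoeff]
    simp only [sub_zero] at this
    rw [this, if_pos hk, hψ k hk]; field_simp
  sinCoeff_eq k hk := by
    have := h.integral_cosSeries_mul_cos hpq hE (β * π / 2) (π / 2) k
    rw [sinCoeff]
    simp only [Real.cos_sub_pi_div_two] at this
    rw [this, if_pos hk, hψ k hk]; field_simp

/-! ### Uniqueness of Fourier coefficients -/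

theorem integral_mul_fourier_eq_zero {F : ℝ → ℝ} (hF : Integrable F periodMeasure)
    (hc : ∀ k, cosCoeff F k = 0) (hs : ∀ k, sinCoeff F k = 0) (n : ℤ) :
    ∫ t, (F t : ℂ) * fourier n (t : AddCircle (2 * π)) ∂periodMeasure = 0 := by
  have hle : -π ≤ π := by linarith [Real.pi_pos]
  have hc' : ∀ k : ℕ, ∫ t, F t * Real.cos (k * t) ∂periodMeasure = 0 := fun k => by
    have := hc k
    rw [cosCoeff, intervalIntegral.integral_of_le hle] at this
    simpa [Real.pi_ne_zero, periodMeasure] using this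
  have hs' : ∀ k : ℕ, ∫ t, F t * Real.sin (k * t) ∂periodMeasure = 0 := fun k => by
    have := hs k
    rw [sinCoeff, intervalIntegral.integral_of_le hle] at this
    simpa [Real.pi_ne_zero, periodMeasure] using this
  have hcn : ∫ t, F t * Real.cos (n * t) ∂periodMeasure = 0 := by
    obtain ⟨k, rfl | rfl⟩ := n.eq_nat_or_neg
    · simpa using hc' k
    · simpa using hc' k
  have hsn : ∫ t, F t * Real.sin (n * t) ∂periodMeasure = 0 := by
    obtain ⟨k, rfl | rfl⟩ := n.eq_nat_or_neg
    · simpa using hs' k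
    · simpa [integral_neg] using hs' k
  have e : ∀ t : ℝ, (F t : ℂ) * fourier n (t : AddCircle (2 * π)) =
      ((F t * Real.cos (n * t) : ℝ) : ℂ) + ((F t * Real.sin (n * t) : ℝ) : ℂ) * Complex.I := fun t => by
    have h1 : (2 * π * Complex.I * n * t / ((2 * π : ℝ) : ℂ)) = ((n * t : ℝ) : ℂ) * Complex.I := by
      have : (π : ℂ) ≠ 0 := by exact_mod_cast Real.pi_ne_zero
      push_cast; field_simp
    rw [fourier_coe_apply, h1, Complex.exp_mul_I, ← Complex.ofReal_cos, ← Complex.ofReal_sin]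
    push_cast; ring
  have hi1 : Integrable (fun t => F t * Real.cos (n * t)) periodMeasure :=
    hF.mul_bdd (c := 1) (Continuous.aestronglyMeasurable (by fun_prop))
      (Eventually.of_forall fun t => Real.abs_cos_le_one _)
  have hi2 : Integrable (fun t => F t * Real.sin (n * t)) periodMeasure :=
    hF.mul_bdd (c := 1) (Continuous.aestronglyMeasurable (by fun_prop))
      (Eventually.of_forall fun t => Real.abs_sin_le_one _)
  simp_rw [e]
  rw [integral_add hi1.ofReal (hi2.ofReal.mul_const _), integral_mul_const, integral_complex_ofReal,
    integral_complex_ofReal, hcn, hsn]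
  simp

/-- Trigonometric polynomials are uniformly dense in the continuous functions on the circle, and
integration against `F` is continuous in the uniform norm. -/
theorem integral_mul_continuousMap_eq_zero {F : ℝ → ℝ} (hF : Integrable F periodMeasure)
    (hc : ∀ k, cosCoeff F k = 0) (hs : ∀ k, sinCoeff F k = 0) (G : C(AddCircle (2 * π), ℂ)) :
    ∫ t, (F t : ℂ) * G (t : AddCircle (2 * π)) ∂periodMeasure = 0 := by
  have : Fact (0 < 2 * π) := ⟨Real.two_pi_pos⟩
  have hint : ∀ P : C(AddCircle (2 * π), ℂ),
      Integrable (fun t : ℝ => (F t : ℂ) * P (t : AddCircle (2 * π))) periodMeasure := fun P =>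
    hF.ofReal.mul_bdd (c := ‖P‖)
      (P.continuous.comp (AddCircle.continuous_mk' (2 * π))).aestronglyMeasurable
      (Eventually.of_forall fun t => P.norm_coe_le_norm _)
  have hspan : ∀ P ∈ Submodule.span ℂ (range <| @fourier (2 * π)),
      ∫ t, (F t : ℂ) * P (t : AddCircle (2 * π)) ∂periodMeasure = 0 := by
    intro P hP
    induction hP using Submodule.span_induction with
    | mem P hP => obtain ⟨n, rfl⟩ := hP; exact integral_mul_fourier_eq_zero hF hc hs n
    | zero => simp
    | add P Q _ _ hP hQ =>
      simp_rw [ContinuousMap.add_apply, mul_add]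
      rw [integral_add (hint P) (hint Q), hP, hQ, add_zero]
    | smul c P _ hP =>
      simp_rw [ContinuousMap.smul_apply, smul_eq_mul, mul_left_comm]
      rw [integral_const_mul, hP, mul_zero]
  have hG : G ∈ closure (Submodule.span ℂ (range <| @fourier (2 * π)) : Set C(AddCircle (2 * π), ℂ)) := by
    rw [← Submodule.topologicalClosure_coe, span_fourier_closure_eq_top]; trivial
  rw [← norm_le_zero_iff]
  refine le_of_forall_pos_le_add fun ε hε => ?_
  rw [zero_add]
  set I := ∫ t, ‖F t‖ ∂periodMeasure
  have hI : 0 ≤ I := integral_nonneg fun _ => norm_nonneg _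
  obtain ⟨P, hP, hd⟩ := Metric.mem_closure_iff.1 hG (ε / (I + 1)) (by positivity)
  calc ‖∫ t, (F t : ℂ) * G (t : AddCircle (2 * π)) ∂periodMeasure‖
      = ‖∫ t, (F t : ℂ) * (G - P) (t : AddCircle (2 * π)) ∂periodMeasure‖ := by
        simp_rw [ContinuousMap.sub_apply, mul_sub]
        rw [integral_sub (hint G) (hint P), hspan P hP, sub_zero]
    _ ≤ ∫ t, ‖F t‖ * (ε / (I + 1)) ∂periodMeasure := by
        refine norm_integral_le_of_norm_le (hF.norm.mul_const _) (Eventually.of_forall fun t => ?_)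
        rw [norm_mul, Complex.norm_real]
        gcongr
        refine ((G - P).norm_coe_le_norm _).trans ?_
        rw [← dist_eq_norm]; exact hd.le
    _ = I * (ε / (I + 1)) := integral_mul_const _ _
    _ ≤ ε := by
        rw [mul_div_assoc', div_le_iff₀ (by positivity)]; nlinarith

/-- An integrable function all of whose Fourier coefficients vanish is zero almost everywhere. -/
theorem ae_eq_zero_of_coeff_eq_zero {F : ℝ → ℝ} (hF : Integrable F periodMeasure)
    (hc : ∀ k, cosCoeff F k = 0) (hs : ∀ k, sinCoeff F k = 0) : F =ᵐ[periodMeasure] 0 := by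
  have : Fact (0 < 2 * π) := ⟨Real.two_pi_pos⟩
  have hFon : IntegrableOn F (Ioc (-π) π) := hF
  have key : ∀ᵐ x : ℝ, x ∈ Ioo (-π) π → F x = 0 := by
    refine isOpen_Ioo.ae_eq_zero_of_integral_contDiff_smul_eq_zero
      (hFon.mono_set Ioo_subset_Ioc_self).locallyIntegrableOn fun g hg _ hsupp => ?_
    -- A test function supported in the open period vanishes at both endpoints, so it is continuous
    -- on the circle.
    have hout : ∀ x, x ∉ Ioo (-π) π → g x = 0 := fun x hx =>
      image_eq_zero_of_notMem_tsupport fun h => hx (hsupp h)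
    have hcont : Continuous (AddCircle.liftIoc (2 * π) (-π) fun x => (g x : ℂ)) := by
      refine AddCircle.liftIoc_continuous ?_ ?_
      · rw [hout (-π) (by simp), hout (-π + 2 * π) (by simp; intro; linarith)]
      · exact (Complex.continuous_ofReal.comp hg.continuous).continuousOn
    have h1 := integral_mul_continuousMap_eq_zero hF hc hs ⟨_, hcont⟩
    have h2 : ∫ t, ((g t • F t : ℝ) : ℂ) ∂periodMeasure = 0 := by
      rw [← h1]
      refine setIntegral_congr_fun measurableSet_Ioc fun t ht => ?_
      simp only [ContinuousMap.coe_mk]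
      rw [AddCircle.liftIoc_coe_apply (by convert ht using 1; ring_nf), smul_eq_mul]
      push_cast; ring
    rw [integral_complex_ofReal, Complex.ofReal_eq_zero] at h2
    rw [← h2, periodMeasure, setIntegral_eq_integral_of_forall_compl_eq_zero]
    intro x hx
    rw [hout x fun h => hx (Ioo_subset_Ioc_self h), zero_smul]
  have hpi : ∀ᵐ x : ℝ, x ≠ π := by simp [ae_iff]
  refine (ae_restrict_iff' measurableSet_Ioc).2 ?_
  filter_upwards [key, hpi] with x hx hxpi hmem
  exact hx ⟨hmem.1, lt_of_le_of_ne hmem.2 hxpi⟩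

/-- Allows an arbitrary kernel from the definition of the class to be replaced by the explicit
cosine series. -/
theorem IsKernel.ae_eq {ψ : ℝ → ℝ} {β : ℝ} {Ψ₁ Ψ₂ : ℝ → ℝ} (h₁ : IsKernel ψ β Ψ₁)
    (h₂ : IsKernel ψ β Ψ₂) : Ψ₁ =ᵐ[periodMeasure] Ψ₂ := by
  have hle : -π ≤ π := by linarith [Real.pi_pos]
  have hi : ∀ {Ψ : ℝ → ℝ}, IsKernel ψ β Ψ → IntervalIntegrable Ψ volume (-π) π := fun h =>
    (intervalIntegrable_iff_integrableOn_Ioc_of_le hle).2 h.integrable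
  have hcos : ∀ k, cosCoeff (Ψ₁ - Ψ₂) k = cosCoeff Ψ₁ k - cosCoeff Ψ₂ k := fun k => by
    simp only [cosCoeff, Pi.sub_apply, sub_mul]
    rw [intervalIntegral.integral_sub ((hi h₁).mul_continuousOn (by fun_prop))
      ((hi h₂).mul_continuousOn (by fun_prop)), mul_sub]
  have hsin : ∀ k, sinCoeff (Ψ₁ - Ψ₂) k = sinCoeff Ψ₁ k - sinCoeff Ψ₂ k := fun k => by
    simp only [sinCoeff, Pi.sub_apply, sub_mul]
    rw [intervalIntegral.integral_sub ((hi h₁).mul_continuousOn (by fun_prop))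
      ((hi h₂).mul_continuousOn (by fun_prop)), mul_sub]
  have h := ae_eq_zero_of_coeff_eq_zero (h₁.integrable.sub h₂.integrable) (fun k => ?_) fun k => ?_
  · filter_upwards [h] with x hx using sub_eq_zero.1 hx
  · rw [hcos]
    rcases Nat.eq_zero_or_pos k with rfl | hk
    · rw [h₁.cosCoeff_zero, h₂.cosCoeff_zero, sub_zero]
    · rw [h₁.cosCoeff_eq k hk, h₂.cosCoeff_eq k hk, sub_self]
  · rw [hsin]
    rcases Nat.eq_zero_or_pos k with rfl | hk
    · simp [sinCoeff]
    · rw [h₁.sinCoeff_eq k hk, h₂.sinCoeff_eq k hk, sub_self]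

/-! ### Convolution with periodic kernels and the Zygmund sum -/

theorem intervalIntegrable_of_periodic {F : ℝ → ℝ} (hF : Function.Periodic F (2 * π))
    (hi : Integrable F periodMeasure) (a b : ℝ) : IntervalIntegrable F volume a b := by
  refine hF.intervalIntegrable (t := -π) Real.two_pi_pos.ne' ?_ a b
  rw [show -π + 2 * π = π by ring]
  exact (intervalIntegrable_iff_integrableOn_Ioc_of_le (by linarith [Real.pi_pos])).2 hi

theorem integral_periodMeasure (F : ℝ → ℝ) : ∫ t, F t ∂periodMeasure = ∫ t in (-π)..π, F t := by
  rw [periodMeasure, intervalIntegral.integral_of_le (by linarith [Real.pi_pos])]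

theorem integrable_comp_sub_left_of_periodic {F : ℝ → ℝ} (hF : Function.Periodic F (2 * π))
    (hi : Integrable F periodMeasure) (x : ℝ) : Integrable (fun t => F (x - t)) periodMeasure := by
  have h := (intervalIntegrable_of_periodic hF hi (x - -π) (x - π)).comp_sub_left x
  rw [sub_sub_cancel, sub_sub_cancel] at h
  exact (intervalIntegrable_iff_integrableOn_Ioc_of_le (by linarith [Real.pi_pos])).1 h

theorem lintegral_comp_sub_left_of_periodic {F : ℝ → ℝ≥0∞} (hF : Function.Periodic F (2 * π)) (x : ℝ) :
    ∫⁻ t, F (x - t) ∂periodMeasure = ∫⁻ t, F t ∂periodMeasure := by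
  have h1 : ∫⁻ t, F (x - t) ∂periodMeasure = ∫⁻ t in Ioc (x - π) (x - π + 2 * π), F t := by
    -- The reflection `t ↦ x - t` swaps open and closed ends, so `Ico` is needed for the image to be
    -- an `Ioc`.
    rw [periodMeasure, show volume.restrict (Ioc (-π) π) = volume.restrict (Ico (-π) π) from
        Measure.restrict_congr_set Ico_ae_eq_Ioc.symm, ← lintegral_indicator measurableSet_Ico,
      ← lintegral_indicator measurableSet_Ioc,
      ← lintegral_sub_left_eq_self ((Ioc (x - π) (x - π + 2 * π)).indicator F) x]
    refine lintegral_congr fun t => ?_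
    by_cases ht : t ∈ Ico (-π) π
    · rw [indicator_of_mem ht, indicator_of_mem]
      exact ⟨by linarith [ht.2], by linarith [ht.1]⟩
    · rw [indicator_of_notMem ht, indicator_of_notMem]
      exact fun h => ht ⟨by linarith [h.2], by linarith [h.1]⟩
  have h2 := (isAddFundamentalDomain_Ioc Real.two_pi_pos (x - π)).setLIntegral_eq
    (isAddFundamentalDomain_Ioc Real.two_pi_pos (-π)) F (by
      rintro ⟨g, hg⟩ y
      obtain ⟨n, rfl⟩ := AddSubgroup.mem_zmultiples_iff.1 hg
      rw [AddSubgroup.vadd_def, vadd_eq_add, add_comm]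
      exact hF.zsmul n y)
  rw [h1, h2, periodMeasure, show -π + 2 * π = π by ring]

/-- For both variables in one period their difference stays in `(-2π, 2π)`, so `Ψ` may be cut off to
two periods and the integrability of convolution integrands on the line applies. -/
theorem integrable_prod_comp_sub {Ψ φ : ℝ → ℝ} (hΨ : Function.Periodic Ψ (2 * π))
    (hΨi : Integrable Ψ periodMeasure) (hφ : Integrable φ periodMeasure) :
    Integrable (fun z : ℝ × ℝ => φ z.2 * Ψ (z.1 - z.2)) (periodMeasure.prod periodMeasure) := by
  have h1 : Integrable ((Ioc (-(2 * π)) (2 * π)).indicator Ψ) volume :=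
    (integrable_indicator_iff measurableSet_Ioc).2
      ((intervalIntegrable_iff_integrableOn_Ioc_of_le (by linarith [Real.pi_pos])).1
        (intervalIntegrable_of_periodic hΨ hΨi _ _))
  have h2 : Integrable ((Ioc (-π) π).indicator φ) volume :=
    (integrable_indicator_iff measurableSet_Ioc).2 hφ
  have h3 := h2.convolution_integrand (ContinuousLinearMap.mul ℝ ℝ) h1
  have h4 := h3.integrableOn (s := Ioc (-π) π ×ˢ Ioc (-π) π)
  rw [periodMeasure, Measure.prod_restrict]
  refine h4.congr_fun (fun z hz => ?_) (measurableSet_Ioc.prod measurableSet_Ioc)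
  have hz1 := hz.1
  have hz2 := hz.2
  simp only [ContinuousLinearMap.mul_apply']
  rw [indicator_of_mem hz2, indicator_of_mem]
  exact ⟨by linarith [hz1.1, hz2.2], by linarith [hz1.2, hz2.1]⟩

theorem cosCoeff_mul_add_sinCoeff_mul {F : ℝ → ℝ} (hF : Integrable F periodMeasure) (k : ℕ) (x : ℝ) :
    cosCoeff F k * Real.cos (k * x) + sinCoeff F k * Real.sin (k * x) =
      (1 / π) * ∫ y in (-π)..π, F y * Real.cos (k * y - k * x) := by
  have hi : IntervalIntegrable F volume (-π) π :=
    (intervalIntegrable_iff_integrableOn_Ioc_of_le (by linarith [Real.pi_pos])).2 hF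
  simp_rw [Real.cos_sub, mul_add, ← mul_assoc]
  rw [intervalIntegral.integral_add ((hi.mul_continuousOn (by fun_prop)).mul_const _)
    ((hi.mul_continuousOn (by fun_prop)).mul_const _), intervalIntegral.integral_mul_const,
    intervalIntegral.integral_mul_const, cosCoeff, sinCoeff]
  ring

theorem integral_comp_sub_mul_cos {F : ℝ → ℝ} (hF : Function.Periodic F (2 * π)) (k : ℕ) (x t : ℝ) :
    ∫ y in (-π)..π, F (y - t) * Real.cos (k * y - k * x) =
      ∫ z in (-π)..π, F z * Real.cos (k * z - k * (x - t)) := by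
  have hper : Function.Periodic (fun z => F z * Real.cos (k * z - k * (x - t))) (2 * π) := fun z => by
    simp only
    rw [hF z, show (k : ℝ) * (z + 2 * π) - k * (x - t) = k * z - k * (x - t) + k * (2 * π) by ring,
      Real.cos_add_nat_mul_two_pi]
  have h1 := intervalIntegral.integral_comp_sub_right
    (fun z => F z * Real.cos (k * z - k * (x - t))) (a := -π) (b := π) t
  have h2 := hper.intervalIntegral_add_eq (-π - t) (-π)
  rw [show -π - t + 2 * π = π - t by ring, show -π + 2 * π = π by ring] at h2
  rw [← h2, ← h1]
  refine intervalIntegral.integral_congr fun y _ => ?_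
  congr 2; ring

/-- Fubini's theorem, followed by a translation of the inner integral over a period. -/
theorem coeff_convolution {Ψ φ : ℝ → ℝ} (hΨ : Function.Periodic Ψ (2 * π))
    (hΨi : Integrable Ψ periodMeasure) (hφ : Integrable φ periodMeasure) (k : ℕ) (x : ℝ) :
    ∫ y in (-π)..π, (∫ t in (-π)..π, Ψ (y - t) * φ t) * Real.cos (k * y - k * x) =
      π * ∫ t in (-π)..π, (cosCoeff Ψ k * Real.cos (k * (x - t)) +
        sinCoeff Ψ k * Real.sin (k * (x - t))) * φ t := by
  have hprod : Integrable (fun z : ℝ × ℝ => φ z.2 * Ψ (z.1 - z.2) * Real.cos (k * z.1 - k * x))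
      (periodMeasure.prod periodMeasure) :=
    (integrable_prod_comp_sub hΨ hΨi hφ).mul_bdd (c := 1)
      (Continuous.aestronglyMeasurable (by fun_prop))
      (Eventually.of_forall fun t => Real.abs_cos_le_one _)
  simp_rw [← integral_periodMeasure]
  calc ∫ y, (∫ t, Ψ (y - t) * φ t ∂periodMeasure) * Real.cos (k * y - k * x) ∂periodMeasure
      = ∫ y, ∫ t, φ t * Ψ (y - t) * Real.cos (k * y - k * x) ∂periodMeasure ∂periodMeasure := by
        simp_rw [integral_mul_const, mul_comm (φ _)]
    _ = ∫ t, ∫ y, φ t * Ψ (y - t) * Real.cos (k * y - k * x) ∂periodMeasure ∂periodMeasure :=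
        integral_integral_swap hprod
    _ = _ := by
        rw [← integral_const_mul]
        refine integral_congr_ae (Eventually.of_forall fun t => ?_)
        simp only
        simp_rw [mul_assoc]
        rw [integral_const_mul, integral_periodMeasure, integral_comp_sub_mul_cos hΨ,
          cosCoeff_mul_add_sinCoeff_mul hΨi]
        field_simp

/-- The trigonometric polynomial whose convolution with `φ` is the Zygmund sum. -/
noncomputable def zygmundKernel (ψ : ℝ → ℝ) (β s : ℝ) (n : ℕ) (u : ℝ) : ℝ :=
  ∑ k ∈ Finset.Ico 1 n, (1 - ((k : ℝ) / n) ^ s) * (ψ k * Real.cos (k * u - β * π / 2))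

theorem continuous_zygmundKernel (ψ : ℝ → ℝ) (β s : ℝ) (n : ℕ) :
    Continuous (zygmundKernel ψ β s n) := by
  unfold zygmundKernel; fun_prop

theorem zygmundKernel_periodic (ψ : ℝ → ℝ) (β s : ℝ) (n : ℕ) :
    Function.Periodic (zygmundKernel ψ β s n) (2 * π) := by
  intro u
  refine Finset.sum_congr rfl fun k _ => ?_
  rw [show (k : ℝ) * (u + 2 * π) - β * π / 2 = k * u - β * π / 2 + k * (2 * π) by ring,
    Real.cos_add_nat_mul_two_pi]

theorem zygmundSum_eq {ψ : ℝ → ℝ} {β s : ℝ} {n : ℕ} {Ψ φ f : ℝ → ℝ} {a₀ : ℝ} (hΨ : IsKernel ψ β Ψ)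
    (hφ : Integrable φ periodMeasure)
    (hf : ∀ x, f x = a₀ / 2 + (1 / π) * ∫ t in (-π)..π, Ψ (x - t) * φ t) (x : ℝ) :
    zygmundSum s n f x =
      a₀ / 2 + (1 / π) * ∫ t in (-π)..π, zygmundKernel ψ β s n (x - t) * φ t := by
  have hle : -π ≤ π := by linarith [Real.pi_pos]
  have hφi : IntervalIntegrable φ volume (-π) π :=
    (intervalIntegrable_iff_integrableOn_Ioc_of_le hle).2 hφ
  have hconv : Integrable (fun y => ∫ t in (-π)..π, Ψ (y - t) * φ t) periodMeasure := by
    have := (integrable_prod_comp_sub hΨ.periodic hΨ.integrable hφ).integral_prod_left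
    simp_rw [integral_periodMeasure, mul_comm (φ _)] at this
    exact this
  have hfi : Integrable f periodMeasure := by
    rw [funext hf]
    exact (integrable_const _).add (hconv.const_mul _)
  have hcoeff : ∀ k : ℕ, cosCoeff f k * Real.cos (k * x) + sinCoeff f k * Real.sin (k * x) =
      (1 / π) * (a₀ / 2 * ∫ y in (-π)..π, Real.cos (k * y - k * x)) +
      (1 / π) * ∫ t in (-π)..π, (cosCoeff Ψ k * Real.cos (k * (x - t)) +
        sinCoeff Ψ k * Real.sin (k * (x - t))) * φ t := fun k => by
    rw [cosCoeff_mul_add_sinCoeff_mul hfi]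
    simp_rw [hf, add_mul]
    rw [intervalIntegral.integral_add (Continuous.intervalIntegrable (by fun_prop) _ _)
      (IntervalIntegrable.mul_continuousOn (((intervalIntegrable_iff_integrableOn_Ioc_of_le hle).2
        hconv).const_mul _) (by fun_prop)), intervalIntegral.integral_const_mul]
    simp_rw [mul_assoc (1 / π)]
    rw [intervalIntegral.integral_const_mul (1 / π), coeff_convolution hΨ.periodic hΨ.integrable hφ]
    simp_rw [add_mul]
    field_simp
  have h0 : cosCoeff f 0 = a₀ := by
    have h := hcoeff 0
    simp [hΨ.cosCoeff_zero] at h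
    rw [h]; field_simp; ring
  have hk : ∀ k : ℕ, 1 ≤ k → cosCoeff f k * Real.cos (k * x) + sinCoeff f k * Real.sin (k * x) =
      (1 / π) * ∫ t in (-π)..π, ψ k * Real.cos (k * (x - t) - β * π / 2) * φ t := fun k hk => by
    rw [hcoeff k]
    have := integral_cos_int_mul_sub (l := (k : ℤ)) (by omega) (k * x)
    rw [Int.cast_natCast] at this
    rw [this, mul_zero, mul_zero, zero_add]
    congr 1
    refine intervalIntegral.integral_congr fun t _ => ?_
    rw [hΨ.cosCoeff_eq k hk, hΨ.sinCoeff_eq k hk, Real.cos_sub]; ring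
  rw [zygmundSum, h0]
  congr 1
  simp_rw [zygmundKernel, Finset.sum_mul]
  rw [intervalIntegral.integral_finsetSum fun k _ =>
    IntervalIntegrable.continuousOn_mul hφi (by fun_prop), Finset.mul_sum]
  refine Finset.sum_congr rfl fun k hk' => ?_
  rw [hk k (Finset.mem_Ico.1 hk').1]
  simp_rw [mul_assoc (1 - ((k : ℝ) / n) ^ s)]
  rw [intervalIntegral.integral_const_mul]
  ring

theorem ofReal_abs_integral_comp_sub_mul_le {p q : ℝ} (hpq : p.HolderConjugate q) {D φ : ℝ → ℝ}
    (hD : Function.Periodic D (2 * π)) (hDi : Integrable D periodMeasure)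
    (hφ : AEStronglyMeasurable φ periodMeasure) (hφ1 : eLpNorm φ (ENNReal.ofReal p) periodMeasure ≤ 1)
    (x : ℝ) :
    ENNReal.ofReal |∫ t in (-π)..π, D (x - t) * φ t| ≤
      (∫⁻ u, ENNReal.ofReal |D u| ^ q ∂periodMeasure) ^ (1 / q) := by
  have hp := hpq.pos
  rw [← integral_periodMeasure, ← Real.enorm_eq_ofReal_abs]
  refine (enorm_integral_le_lintegral_enorm _).trans ?_
  simp_rw [enorm_mul]
  have hDm := (integrable_comp_sub_left_of_periodic hD hDi x).aestronglyMeasurable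
  refine (ENNReal.lintegral_mul_le_Lp_mul_Lq _ hpq.symm hDm.enorm hφ.enorm).trans ?_
  have h1 : (∫⁻ t, ‖φ t‖ₑ ^ p ∂periodMeasure) ^ (1 / p) ≤ 1 := by
    rw [eLpNorm_eq_lintegral_rpow_enorm_toReal (by simpa using hp) ENNReal.ofReal_ne_top,
      ENNReal.toReal_ofReal hp.le] at hφ1
    exact hφ1
  have h2 := lintegral_comp_sub_left_of_periodic (F := fun u => ‖D u‖ₑ ^ q)
    (fun u => by simp only [hD u]) x
  rw [h2]
  simp_rw [← Real.enorm_eq_ofReal_abs]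
  exact mul_le_of_le_one_right' h1

/-! ### The kernel of the approximation error -/

/-- The moduli of the Fourier coefficients of the kernel of `f - Z_n^s f`. -/
noncomputable def errorCoeff (ψ : ℝ → ℝ) (s : ℝ) (n k : ℕ) : ℝ := min (((k : ℝ) / n) ^ s) 1 * ψ k

theorem errorCoeff_zero {ψ : ℝ → ℝ} {s : ℝ} (hs : 0 < s) (n : ℕ) : errorCoeff ψ s n 0 = 0 := by
  simp [errorCoeff, Real.zero_rpow hs.ne']

theorem errorCoeff_of_ge {ψ : ℝ → ℝ} {s : ℝ} (hs : 0 < s) {n k : ℕ} (hn : 1 ≤ n) (h : n ≤ k) :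
    errorCoeff ψ s n k = ψ k := by
  have hn0 : (0 : ℝ) < n := by exact_mod_cast hn
  rw [errorCoeff, min_eq_right, one_mul]
  exact Real.one_le_rpow ((one_le_div hn0).2 (by exact_mod_cast h)) hs.le

theorem errorCoeff_of_le {ψ : ℝ → ℝ} {s : ℝ} (hs : 0 < s) {n k : ℕ} (hn : 1 ≤ n) (h : k ≤ n) :
    errorCoeff ψ s n k = ((k : ℝ) / n) ^ s * ψ k := by
  have hn0 : (0 : ℝ) < n := by exact_mod_cast hn
  rw [errorCoeff, min_eq_left]
  exact Real.rpow_le_one (by positivity) ((div_le_one hn0).2 (by exact_mod_cast h)) hs.le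

theorem one_add_pow_le_one_add_three_pow_mul {x : ℝ} (hx : 0 ≤ x) (hx1 : x ≤ 1) (N : ℕ) :
    (1 + x) ^ N ≤ 1 + 3 ^ N * x := by
  induction N with
  | zero => simp [hx]
  | succ N ih =>
    have h3 : (1 : ℝ) ≤ 3 ^ N := one_le_pow₀ (by norm_num)
    calc (1 + x) ^ (N + 1) = (1 + x) ^ N * (1 + x) := pow_succ _ _
      _ ≤ (1 + 3 ^ N * x) * (1 + x) := by gcongr
      _ ≤ 1 + 3 ^ (N + 1) * x := by
        rw [pow_succ]; nlinarith [mul_nonneg (by positivity : (0 : ℝ) ≤ 3 ^ N * x) (sub_nonneg.2 hx1)]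

theorem exists_rpow_succ_div_le (s : ℝ) : ∃ M : ℝ, 0 ≤ M ∧ ∀ k : ℕ, 1 ≤ k →
    (((k + 1 : ℕ) : ℝ) / k) ^ s ≤ 1 + M / k := by
  obtain ⟨N, hN⟩ := exists_nat_ge s
  refine ⟨3 ^ N, by positivity, fun k hk => ?_⟩
  have hk0 : (1 : ℝ) ≤ k := by exact_mod_cast hk
  have e : ((k + 1 : ℕ) : ℝ) / k = 1 + 1 / k := by push_cast; field_simp
  have hx : 0 ≤ 1 / (k : ℝ) := by positivity
  rw [e]
  calc (1 + 1 / (k : ℝ)) ^ s ≤ (1 + 1 / (k : ℝ)) ^ (N : ℝ) :=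
        Real.rpow_le_rpow_of_exponent_le (by linarith) hN
    _ = (1 + 1 / (k : ℝ)) ^ N := Real.rpow_natCast _ _
    _ ≤ 1 + 3 ^ N * (1 / k) :=
        one_add_pow_le_one_add_three_pow_mul hx ((div_le_one (by linarith)).2 hk0) N
    _ = _ := by ring

/-- The multiplier grows from `k` to `k + 1` by at most `((k+1)/k)^s ≤ 1 + M/k`, whatever `n` is.
Multiplying by the growth factor of `ψ` and using `k² ≥ k` gives `M + C + M * C`, free of `n`. -/
theorem exists_regular_errorCoeff {ψ : ℝ → ℝ} {s : ℝ} (hs : 0 < s) (hpos : ∀ k : ℕ, 1 ≤ k → 0 ≤ ψ k)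
    {C : ℝ} (hC : 0 ≤ C) (hgrow : ∀ k : ℕ, 1 ≤ k → ψ (k + 1 : ℕ) ≤ (1 + C / k) * ψ k)
    {B a : ℝ} (ha : 0 < a) (hdec : ∀ k : ℕ, 1 ≤ k → ψ k ≤ B * (k : ℝ) ^ (-a)) :
    ∃ C' : ℝ, ∀ n : ℕ, 1 ≤ n → Regular C' (errorCoeff ψ s n) := by
  obtain ⟨M, hM, hMk⟩ := exists_rpow_succ_div_le s
  refine ⟨M + C + M * C, fun n hn => ?_⟩
  have hn0 : (0 : ℝ) < n := by exact_mod_cast hn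
  have hmin : ∀ k : ℕ, 0 ≤ min (((k : ℝ) / n) ^ s) 1 := fun k => le_min (by positivity) zero_le_one
  have hnn : ∀ k, 0 ≤ errorCoeff ψ s n k := fun k => by
    rcases Nat.eq_zero_or_pos k with rfl | hk
    · rw [errorCoeff_zero hs]
    · exact mul_nonneg (hmin k) (hpos k hk)
  have hle : ∀ k : ℕ, 1 ≤ k → errorCoeff ψ s n k ≤ B * (k : ℝ) ^ (-a) := fun k hk =>
    (mul_le_of_le_one_left (hpos k hk) (min_le_right _ _)).trans (hdec k hk)
  refine ⟨by positivity, hnn, fun k hk => ?_, ?_, ?_⟩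
  · have hk0 : (1 : ℝ) ≤ k := by exact_mod_cast hk
    have h1 : 1 ≤ (((k + 1 : ℕ) : ℝ) / k) ^ s :=
      Real.one_le_rpow ((one_le_div (by linarith)).2 (by push_cast; linarith)) hs.le
    have h2 : min ((((k + 1 : ℕ) : ℝ) / n) ^ s) 1 ≤ (1 + M / k) * min (((k : ℝ) / n) ^ s) 1 := by
      refine le_trans ?_ (mul_le_mul_of_nonneg_right (hMk k hk) (hmin k))
      rw [mul_min_of_nonneg _ _ (by positivity), mul_one]
      refine min_le_min (le_of_eq ?_) h1
      rw [← Real.mul_rpow (by positivity) (by positivity)]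
      congr 1; field_simp
    have h3 : (1 + M / k) * (1 + C / k) ≤ 1 + (M + C + M * C) / k := by
      have : M * C / (k * k) ≤ M * C / k := by
        gcongr; nlinarith
      have e : (1 + M / k) * (1 + C / k) = 1 + M / k + C / k + M * C / (k * k) := by
        field_simp; ring
      rw [e, add_div, add_div]; linarith
    calc errorCoeff ψ s n (k + 1)
        ≤ ((1 + M / k) * min (((k : ℝ) / n) ^ s) 1) * ((1 + C / k) * ψ k) :=
          mul_le_mul h2 (hgrow k hk) (hpos _ (by omega)) (mul_nonneg (by positivity) (hmin k))
      _ = ((1 + M / k) * (1 + C / k)) * errorCoeff ψ s n k := by rw [errorCoeff]; ring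
      _ ≤ _ := mul_le_mul_of_nonneg_right h3 (hnn k)
  · have hlim : Tendsto (fun k : ℕ => B * (k : ℝ) ^ (-a)) atTop (𝓝 0) := by
      simpa using ((tendsto_rpow_neg_atTop ha).comp tendsto_natCast_atTop_atTop).const_mul B
    refine squeeze_zero' (Eventually.of_forall hnn) ?_ hlim
    filter_upwards [eventually_ge_atTop 1] with k hk using hle k hk
  · have hsum : Summable fun k : ℕ => B * (k : ℝ) ^ (-a - 1) :=
      (Real.summable_nat_rpow.2 (by linarith)).mul_left B
    refine hsum.of_norm_bounded_eventually_nat ?_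
    filter_upwards [eventually_ge_atTop 1] with k hk
    have hk0 : (0 : ℝ) < k := by exact_mod_cast hk
    rw [Real.norm_of_nonneg (div_nonneg (hnn k) hk0.le), Real.rpow_sub_one hk0.ne', ← mul_div_assoc]
    gcongr
    exact hle k hk

theorem cosSeries_sub_zygmundKernel {ψ : ℝ → ℝ} {s C : ℝ} (hs : 0 < s)
    (hreg : ∀ n : ℕ, 1 ≤ n → Regular C (errorCoeff ψ s n)) (β : ℝ) {n : ℕ} (hn : 1 ≤ n) {u : ℝ}
    (hu0 : u ≠ 0) (hu : |u| ≤ π) :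
    cosSeries (errorCoeff ψ s 1) (β * π / 2) u - zygmundKernel ψ β s n u =
      cosSeries (errorCoeff ψ s n) (β * π / 2) u := by
  refine tendsto_nhds_unique (((hreg 1 le_rfl).tendsto_cosSum (β * π / 2) hu0 hu).sub_const _) ?_
  refine ((hreg n hn).tendsto_cosSum (β * π / 2) hu0 hu).congr' ?_
  filter_upwards [eventually_ge_atTop n] with N hN
  rw [cosSum, cosSum, zygmundKernel, ← Finset.sum_Ico_consecutive _ hn hN,
    ← Finset.sum_Ico_consecutive _ hn hN, add_sub_right_comm, ← Finset.sum_sub_distrib]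
  congr 1
  · refine Finset.sum_congr rfl fun k hk => ?_
    rw [Finset.mem_Ico] at hk
    rw [errorCoeff_of_le hs hn hk.2.le, errorCoeff_of_ge hs le_rfl hk.1]
    ring
  · refine Finset.sum_congr rfl fun k hk => ?_
    rw [Finset.mem_Ico] at hk
    rw [errorCoeff_of_ge hs hn hk.1, errorCoeff_of_ge hs le_rfl (hn.trans hk.1)]

/-- The error of approximation is controlled by the Hardy–Littlewood norm of the error kernel. -/
theorem hasKernel_and_exists_zygmundError_le {ψ : ℝ → ℝ} {s p : ℝ} (hp : 1 < p) (hs : 0 < s)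
    (hpos : ∀ k : ℕ, 1 ≤ k → 0 ≤ ψ k)
    {C : ℝ} (hC : 0 ≤ C) (hgrow : ∀ k : ℕ, 1 ≤ k → ψ (k + 1 : ℕ) ≤ (1 + C / k) * ψ k)
    {B a : ℝ} (ha : 0 < a) (hdec : ∀ k : ℕ, 1 ≤ k → ψ k ≤ B * (k : ℝ) ^ (-a))
    (hE : energy p p.conjExponent (errorCoeff ψ s 1) ≠ ⊤) :
    (∀ β : ℝ, HasKernel ψ β p) ∧ ∃ K : ℝ, 0 < K ∧ ∀ (β : ℝ) (n : ℕ), 1 ≤ n →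
      zygmundError ψ β p s n ≤ ENNReal.ofReal K *
        energy p p.conjExponent (errorCoeff ψ s n) ^ (1 / p.conjExponent) := by
  have hpq : p.HolderConjugate p.conjExponent := Real.HolderConjugate.conjExponent hp
  set q := p.conjExponent
  have hq := hpq.symm.pos
  obtain ⟨C', hreg⟩ := exists_regular_errorCoeff hs hpos hC hgrow ha hdec
  -- For `n = 1` the multiplier is one at every `k ≥ 1`, so `errorCoeff ψ s 1` is the coefficient
  -- sequence of `Ψ_β` itself.
  have hker : ∀ β, IsKernel ψ β (cosSeries (errorCoeff ψ s 1) (β * π / 2)) := fun β =>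
    (hreg 1 le_rfl).isKernel_cosSeries hpq hE β fun k hk => errorCoeff_of_ge hs le_rfl hk
  refine ⟨fun β => ⟨_, hker β, (hreg 1 le_rfl).memLp_cosSeries hpq hE _⟩, ?_⟩
  obtain ⟨K, hK, hKw⟩ := Regular.exists_lintegral_cosSeries_le hpq C'
  refine ⟨(1 / π) * K ^ (1 / q), by positivity, fun β n hn => ?_⟩
  refine iSup₂_le fun f hf => iSup_le fun x => ?_
  obtain ⟨Ψ, hΨ, hΨq, a₀, φ, -, hφp, hφ1, -, hfx⟩ := hf
  have hφi : Integrable φ periodMeasure := hφp.integrable (by simpa using hp.le)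
  set D : ℝ → ℝ := fun u => Ψ u - zygmundKernel ψ β s n u with hD
  have hDper : Function.Periodic D (2 * π) := fun u => by
    simp only [hD, hΨ.periodic u, zygmundKernel_periodic ψ β s n u]
  have hTi : ∀ x, Integrable (fun t => zygmundKernel ψ β s n (x - t) * φ t) periodMeasure := fun x => by
    have hc : Continuous fun t => zygmundKernel ψ β s n (x - t) :=
      (continuous_zygmundKernel ψ β s n).comp (by fun_prop)
    exact IntegrableOn.continuousOn_mul_of_subset hc.continuousOn hφi isCompact_Icc
      measurableSet_Ioc Ioc_subset_Icc_self
  have hTi0 : Integrable (zygmundKernel ψ β s n) periodMeasure :=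
    (continuous_zygmundKernel ψ β s n).integrableOn_Ioc
  have hΨx : MemLp (fun t => Ψ (x - t)) (ENNReal.ofReal q) periodMeasure := by
    refine ⟨(integrable_comp_sub_left_of_periodic hΨ.periodic hΨ.integrable x).aestronglyMeasurable, ?_⟩
    have h := hΨq.2
    rw [eLpNorm_lt_top_iff_lintegral_rpow_enorm_lt_top (by simpa using hq) ENNReal.ofReal_ne_top] at h ⊢
    have h2 := lintegral_comp_sub_left_of_periodic
      (F := fun u => ‖Ψ u‖ₑ ^ (ENNReal.ofReal q).toReal) (fun u => by simp only [hΨ.periodic u]) x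
    rw [h2]; exact h
  have hΨφ : Integrable (fun t => Ψ (x - t) * φ t) periodMeasure := by
    have : (ENNReal.ofReal q).HolderConjugate (ENNReal.ofReal p) := hpq.symm.ennrealOfReal
    exact hΨx.integrable_mul hφp
  have hdiff : f x - zygmundSum s n f x = (1 / π) * ∫ t in (-π)..π, D (x - t) * φ t := by
    rw [zygmundSum_eq hΨ hφi hfx, hfx x, add_sub_add_left_eq_sub, ← mul_sub]
    simp_rw [← integral_periodMeasure]
    rw [← integral_sub hΨφ (hTi x)]
    simp_rw [hD, sub_mul]
  have hDae : ∀ᵐ u ∂periodMeasure, D u = cosSeries (errorCoeff ψ s n) (β * π / 2) u := by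
    filter_upwards [hΨ.ae_eq (hker β), ae_periodMeasure] with u h1 h2
    rw [hD]
    simp only
    rw [h1, cosSeries_sub_zygmundKernel hs hreg β hn h2.1 h2.2]
  rw [hdiff, abs_mul, abs_of_pos (by positivity : (0 : ℝ) < 1 / π), ENNReal.ofReal_mul (by positivity),
    ENNReal.ofReal_mul (by positivity), mul_assoc]
  gcongr ENNReal.ofReal _ * ?_
  refine (ofReal_abs_integral_comp_sub_mul_le hpq hDper (hΨ.integrable.sub hTi0) hφp.1 hφ1 x).trans ?_
  rw [← ENNReal.ofReal_rpow_of_nonneg hK.le (by positivity), ← ENNReal.mul_rpow_of_nonneg _ _ (by positivity)]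
  gcongr
  rw [lintegral_congr_ae (hDae.mono fun u hu => by rw [hu])]
  exact hKw _ (hreg n hn) _

/-! ### Power-like behaviour of `g`: cases 1 and 3 -/

theorem gFun_eq_mul {ψ : ℝ → ℝ} {s p t : ℝ} (ht : 0 < t) :
    gFun ψ s p t = t ^ s * (ψ t * t ^ (1 / p)) := by
  rw [gFun, Real.rpow_add ht]; ring

theorem pos_of_gFun_pos {ψ : ℝ → ℝ} {s p t : ℝ} (ht : 0 < t) (h : 0 < gFun ψ s p t) : 0 < ψ t :=
  pos_of_mul_pos_left h (by positivity)

theorem errorCoeff_mul_of_le {ψ : ℝ → ℝ} {s p : ℝ} (hs : 0 < s) {n k : ℕ} (hk : 1 ≤ k) (h : k ≤ n) :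
    errorCoeff ψ s n k * (k : ℝ) ^ (1 / p) = (1 / (n : ℝ) ^ s) * gFun ψ s p k := by
  have hk0 : (0 : ℝ) < k := by exact_mod_cast hk
  have hn0 : (0 : ℝ) < n := by exact_mod_cast hk.trans h
  rw [errorCoeff_of_le hs (hk.trans h) h, gFun_eq_mul hk0, Real.div_rpow hk0.le hn0.le]
  ring

theorem errorCoeff_mul_of_ge {ψ : ℝ → ℝ} {s p : ℝ} (hs : 0 < s) {n k : ℕ} (hn : 1 ≤ n) (h : n ≤ k) :
    errorCoeff ψ s n k * (k : ℝ) ^ (1 / p) =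
      (1 / (n : ℝ) ^ s) * (((n : ℝ) / k) ^ s * gFun ψ s p k) := by
  have hk0 : (0 : ℝ) < k := by exact_mod_cast hn.trans h
  have hn0 : (0 : ℝ) < n := by exact_mod_cast hn
  rw [errorCoeff_of_ge hs hn h, gFun_eq_mul hk0, Real.div_rpow hn0.le hk0.le]
  field_simp

/-- Common form of both cases: `X n` is the height of the profile and `j n` the position of its
peak, which is `n` in case 1 and `1` in case 3. -/
theorem exists_zygmundError_le_of_ratioKernel {ψ : ℝ → ℝ} {s p : ℝ} (hp : 1 < p) (hs : 0 < s)
    (hpos : ∀ k : ℕ, 1 ≤ k → 0 ≤ ψ k) (hanti : AntitoneOn ψ (Ici 1))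
    {B a : ℝ} (ha : 0 < a) (hdec : ∀ k : ℕ, 1 ≤ k → ψ k ≤ B * (k : ℝ) ^ (-a))
    {c : ℝ} (hc : 0 < c) (X : ℕ → ℝ) (j : ℕ → ℕ) (hj : ∀ n, 1 ≤ n → 1 ≤ j n)
    (hX : ∀ n : ℕ, 1 ≤ n → 0 ≤ X n)
    (h : ∀ n k : ℕ, 1 ≤ n → 1 ≤ k →
      errorCoeff ψ s n k * (k : ℝ) ^ (1 / p) ≤ X n * ratioKernel c (j n) k) :
    (∀ β : ℝ, HasKernel ψ β p) ∧ ∃ K : ℝ, 0 < K ∧ ∀ (β : ℝ) (n : ℕ), 1 ≤ n →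
      zygmundError ψ β p s n ≤ ENNReal.ofReal (K * X n) := by
  have hpq : p.HolderConjugate p.conjExponent := Real.HolderConjugate.conjExponent hp
  have hen := fun n hn => energy_le_of_le_ratioKernel hpq hc (hj n hn) (hX n hn) (h n · hn)
  have hgrow : ∀ k : ℕ, 1 ≤ k → ψ (k + 1 : ℕ) ≤ (1 + 0 / k) * ψ k := fun k hk => by
    have hk1 : (1 : ℝ) ≤ k := by exact_mod_cast hk
    simpa using hanti (mem_Ici.2 hk1) (mem_Ici.2 (by linarith : (1 : ℝ) ≤ k + 1)) (by linarith)
  obtain ⟨h1, K, hK, hKn⟩ := hasKernel_and_exists_zygmundError_le hp hs hpos le_rfl hgrow ha hdec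
    (ne_top_of_le_ne_top (ENNReal.mul_ne_top (ENNReal.rpow_ne_top_of_nonneg hpq.symm.nonneg
      ENNReal.ofReal_ne_top) ENNReal.ofReal_ne_top) (hen 1 le_rfl))
  set q := p.conjExponent
  have hq := hpq.symm.pos
  have hc' : 0 < min c 1 := lt_min hc one_pos
  refine ⟨h1, K * (2 / min c 1) ^ (1 / q), by positivity, fun β n hn => (hKn β n hn).trans ?_⟩
  rw [mul_assoc, ENNReal.ofReal_mul hK.le, ENNReal.ofReal_mul (by positivity)]
  gcongr
  refine (ENNReal.rpow_le_rpow (hen n hn) (by positivity)).trans (le_of_eq ?_)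
  rw [ENNReal.mul_rpow_of_nonneg _ _ (by positivity), ← ENNReal.rpow_mul, mul_one_div_cancel hq.ne',
    ENNReal.rpow_one, ENNReal.ofReal_rpow_of_nonneg (by positivity) (by positivity), mul_comm]

theorem exists_zygmundError_le_of_theta {ψ : ℝ → ℝ} {s p : ℝ} (hp : 1 < p) (hs : 0 < s)
    (hθ : ψ ∈ Theta p) (hg : gFun ψ s p ∈ APlus) :
    (∀ β : ℝ, HasKernel ψ β p) ∧ ∃ K : ℝ, 0 < K ∧ ∀ (β : ℝ) (n : ℕ), 1 ≤ n →
      zygmundError ψ β p s n ≤ ENNReal.ofReal (K * (ψ n * (n : ℝ) ^ (1 / p))) := by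
  obtain ⟨hanti, α, hα, K, -, hKt⟩ := hθ
  obtain ⟨hgpos, ε, hε, hmono⟩ := hg
  have hpos : ∀ k : ℕ, 1 ≤ k → 0 < ψ k := fun k hk => by
    have hk1 : (1 : ℝ) ≤ k := by exact_mod_cast hk
    exact pos_of_gFun_pos (by linarith) (hgpos k hk1)
  -- The condition in `Theta` concerns only `t₂ < t₁`; a constant at least one also covers `k = n`.
  set K' := max K 1
  have hK'1 : 1 ≤ K' := le_max_right _ _
  have hK' : ∀ n k : ℕ, 1 ≤ n → n ≤ k → (k : ℝ) ^ α * ψ k ≤ K' * ((n : ℝ) ^ α * ψ n) := by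
    intro n k hn hk
    have hn1 : (1 : ℝ) ≤ n := by exact_mod_cast hn
    have h0 : 0 ≤ (n : ℝ) ^ α * ψ n := mul_nonneg (by positivity) (hpos n hn).le
    rcases hk.eq_or_lt with rfl | hlt
    · exact le_mul_of_one_le_left h0 hK'1
    · refine (hKt k n hn1 (by exact_mod_cast hlt)).trans ?_
      gcongr
      exact le_max_left _ _
  have hα0 : 0 < α := lt_trans (by positivity) hα
  -- Membership in `APlus` gives decay of order `ε` below `n`; the `Theta` condition gives decay of
  -- order `α - 1/p` above `n`.
  set c := min ε (α - 1 / p)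
  have hc : 0 < c := lt_min hε (sub_pos.2 hα)
  have hdec : ∀ k : ℕ, 1 ≤ k → ψ k ≤ K' * ψ 1 * (k : ℝ) ^ (-α) := fun k hk => by
    have hk0 : (0 : ℝ) < k := by exact_mod_cast hk
    have := hK' 1 k le_rfl hk
    rw [Nat.cast_one, Real.one_rpow, one_mul] at this
    rw [Real.rpow_neg hk0.le, ← div_eq_mul_inv, le_div_iff₀ (by positivity), mul_comm]
    exact this
  have hbound : ∀ n k : ℕ, 1 ≤ n → 1 ≤ k → errorCoeff ψ s n k * (k : ℝ) ^ (1 / p) ≤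
      K' * (ψ n * (n : ℝ) ^ (1 / p)) * ratioKernel c (id n) k := fun n k hn hk => by
    have hk0 : (1 : ℝ) ≤ k := by exact_mod_cast hk
    have hn0 : (1 : ℝ) ≤ n := by exact_mod_cast hn
    have hX : 0 ≤ ψ n * (n : ℝ) ^ (1 / p) := mul_nonneg (hpos n hn).le (by positivity)
    rcases le_total k n with h | h
    · have hkn : (k : ℝ) ≤ n := by exact_mod_cast h
      have h2 := hmono (mem_Ici.2 hk0) (mem_Ici.2 hn0) hkn
      simp only at h2
      have hkε : (k : ℝ) ^ (-ε) * (k : ℝ) ^ ε = 1 := by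
        rw [← Real.rpow_add (by linarith), neg_add_cancel, Real.rpow_zero]
      have h3 : gFun ψ s p k ≤ gFun ψ s p n * ((k : ℝ) / n) ^ ε := by
        calc gFun ψ s p k = gFun ψ s p k * (k : ℝ) ^ (-ε) * (k : ℝ) ^ ε := by
              rw [mul_assoc, hkε, mul_one]
          _ ≤ gFun ψ s p n * (n : ℝ) ^ (-ε) * (k : ℝ) ^ ε := by gcongr
          _ = _ := by
            rw [Real.div_rpow (by linarith) (by linarith), Real.rpow_neg (by linarith)]; ring
      rw [errorCoeff_mul_of_le hs hk h, id, ratioKernel_of_le c h]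
      have h4 : ((k : ℝ) / n) ^ ε ≤ ((k : ℝ) / n) ^ c :=
        Real.rpow_le_rpow_of_exponent_ge (by positivity) ((div_le_one (by linarith)).2 hkn) (min_le_left _ _)
      calc 1 / (n : ℝ) ^ s * gFun ψ s p k ≤ 1 / (n : ℝ) ^ s * (gFun ψ s p n * ((k : ℝ) / n) ^ ε) := by
            gcongr
        _ = ψ n * (n : ℝ) ^ (1 / p) * ((k : ℝ) / n) ^ ε := by
            rw [gFun_eq_mul (by linarith)]; field_simp
        _ ≤ K' * (ψ n * (n : ℝ) ^ (1 / p)) * ((k : ℝ) / n) ^ c := by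
            exact mul_le_mul (le_mul_of_one_le_left hX hK'1) h4 (by positivity)
              (mul_nonneg (by linarith) hX)
    · have hkn : (n : ℝ) ≤ k := by exact_mod_cast h
      have h2 := hK' n k hn h
      rw [errorCoeff_of_ge hs hn h, id, ratioKernel_of_ge c h]
      have h4 : ((n : ℝ) / k) ^ (α - 1 / p) ≤ ((n : ℝ) / k) ^ c :=
        Real.rpow_le_rpow_of_exponent_ge (by positivity) ((div_le_one (by linarith)).2 hkn)
          (min_le_right _ _)
      calc ψ k * (k : ℝ) ^ (1 / p) = (k : ℝ) ^ α * ψ k * (k : ℝ) ^ (1 / p - α) := by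
            rw [Real.rpow_sub (by linarith)]; field_simp
        _ ≤ K' * ((n : ℝ) ^ α * ψ n) * (k : ℝ) ^ (1 / p - α) := by gcongr
        _ = K' * (ψ n * (n : ℝ) ^ (1 / p)) * ((n : ℝ) / k) ^ (α - 1 / p) := by
            rw [Real.div_rpow (by linarith) (by linarith), Real.rpow_sub (by linarith),
              Real.rpow_sub (by linarith), Real.rpow_sub (by linarith)]
            field_simp
        _ ≤ _ := by gcongr
  obtain ⟨h1, M, hM, hMn⟩ := exists_zygmundError_le_of_ratioKernel hp hs (fun k hk => (hpos k hk).le) hanti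
    (B := K' * ψ 1) hα0 hdec hc (fun n => K' * (ψ n * (n : ℝ) ^ (1 / p))) id
    (fun n hn => hn) (fun n hn => mul_nonneg (by linarith) (mul_nonneg (hpos n hn).le (by positivity)))
    hbound
  refine ⟨h1, M * K', by positivity, fun β n hn => (hMn β n hn).trans (le_of_eq ?_)⟩
  rw [mul_assoc]

theorem exists_zygmundError_le_of_aminus {ψ : ℝ → ℝ} {s p : ℝ} (hp : 1 < p) (hs : 0 < s)
    (hg : gFun ψ s p ∈ AMinus) :
    (∀ β : ℝ, HasKernel ψ β p) ∧ ∃ K : ℝ, 0 < K ∧ ∀ (β : ℝ) (n : ℕ), 1 ≤ n →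
      zygmundError ψ β p s n ≤ ENNReal.ofReal (K * (1 / (n : ℝ) ^ s)) := by
  obtain ⟨hgpos, ε, hε, hanti⟩ := hg
  have hψpos : ∀ t, 1 ≤ t → 0 < ψ t := fun t ht => pos_of_gFun_pos (by linarith) (hgpos t ht)
  have hp0 : 0 < p := by linarith
  have hψ : ∀ t, 1 ≤ t → ψ t = gFun ψ s p t * t ^ ε * t ^ (-(ε + (s + 1 / p))) := fun t ht => by
    have ht0 : 0 < t := by linarith
    rw [gFun, Real.rpow_neg ht0.le, Real.rpow_add ht0 ε]; field_simp
  -- Monotonicity is automatic here: `ψ` is the product of the non-increasing `g(t) t^ε` and a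
  -- negative power of `t`.
  have hψanti : AntitoneOn ψ (Ici 1) := by
    intro x hx y hy hxy
    have hx1 : 1 ≤ x := hx
    have hy1 : 1 ≤ y := hy
    rw [hψ x hx1, hψ y hy1]
    have h1 := hanti hx hy hxy
    simp only at h1
    have h2 : y ^ (-(ε + (s + 1 / p))) ≤ x ^ (-(ε + (s + 1 / p))) :=
      Real.rpow_le_rpow_of_nonpos (by linarith) hxy (by rw [neg_nonpos]; positivity)
    exact mul_le_mul h1 h2 (by positivity) (mul_nonneg (hgpos x hx1).le (by positivity))
  have hg1 : ∀ t, 1 ≤ t → gFun ψ s p t * t ^ ε ≤ gFun ψ s p 1 := fun t ht => by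
    simpa using hanti (mem_Ici.2 le_rfl) (mem_Ici.2 ht) ht
  have hG := hgpos 1 le_rfl
  have hdec : ∀ k : ℕ, 1 ≤ k → ψ k ≤ gFun ψ s p 1 * (k : ℝ) ^ (-(ε + (s + 1 / p))) := fun k hk => by
    have hk1 : (1 : ℝ) ≤ k := by exact_mod_cast hk
    rw [hψ k hk1]
    gcongr
    exact hg1 k hk1
  have hbound : ∀ n k : ℕ, 1 ≤ n → 1 ≤ k → errorCoeff ψ s n k * (k : ℝ) ^ (1 / p) ≤
      gFun ψ s p 1 * (1 / (n : ℝ) ^ s) * ratioKernel ε 1 k := fun n k hn hk => by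
    have hk1 : (1 : ℝ) ≤ k := by exact_mod_cast hk
    have hn1 : (1 : ℝ) ≤ n := by exact_mod_cast hn
    have h2 : errorCoeff ψ s n k * (k : ℝ) ^ (1 / p) ≤ 1 / (n : ℝ) ^ s * gFun ψ s p k := by
      rcases le_total k n with h | h
      · exact (errorCoeff_mul_of_le hs hk h).le
      · rw [errorCoeff_mul_of_ge hs hn h]
        gcongr
        refine mul_le_of_le_one_left (hgpos k hk1).le (Real.rpow_le_one (by positivity) ?_ hs.le)
        rw [div_le_one (by linarith)]; exact_mod_cast h
    refine h2.trans ?_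
    rw [ratioKernel_of_ge ε hk, Nat.cast_one, Real.div_rpow zero_le_one (by linarith), Real.one_rpow,
      mul_comm (gFun ψ s p 1), mul_assoc]
    gcongr
    rw [mul_one_div, le_div_iff₀ (by positivity)]
    exact hg1 k hk1
  obtain ⟨h1, M, hM, hMn⟩ := exists_zygmundError_le_of_ratioKernel hp hs
    (fun k hk => (hψpos k (by exact_mod_cast hk)).le) hψanti (B := gFun ψ s p 1)
    (a := ε + (s + 1 / p)) (by positivity) hdec hε
    (fun n => gFun ψ s p 1 * (1 / (n : ℝ) ^ s)) (fun _ => 1) (fun _ _ => le_rfl)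
    (fun n hn => by positivity) hbound
  refine ⟨h1, M * gFun ψ s p 1, by positivity, fun β n hn => (hMn β n hn).trans (le_of_eq ?_)⟩
  rw [mul_assoc]

/-! ### Slowly varying `g`: case 2 -/

/-- On the compact `[1, T]` the ratio of maximum to minimum is finite, so eventual monotonicity
becomes monotonicity up to a constant on the whole half-line. -/
theorem exists_le_mul_of_monotoneOn_Ici {F : ℝ → ℝ} (hF : ContinuousOn F (Ici 1))
    (hpos : ∀ t, 1 ≤ t → 0 < F t) {T : ℝ} (hT : 1 ≤ T) (hmono : MonotoneOn F (Ici T)) :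
    ∃ M : ℝ, 0 < M ∧ ∀ a b, 1 ≤ a → a ≤ b → F a ≤ M * F b := by
  have hne : (Icc 1 T).Nonempty := nonempty_Icc.2 hT
  have hc : ContinuousOn F (Icc 1 T) := hF.mono Icc_subset_Ici_self
  obtain ⟨x, hx, hxmin⟩ := isCompact_Icc.exists_isMinOn hne hc
  obtain ⟨y, hy, hymax⟩ := isCompact_Icc.exists_isMaxOn hne hc
  have hx0 := hpos x hx.1
  have hxy : F x ≤ F y := hymax hx
  have hM1 : 1 ≤ F y / F x := (one_le_div hx0).2 hxy
  have key : ∀ a ∈ Icc 1 T, ∀ b ∈ Icc 1 T, F a ≤ F y / F x * F b := fun a ha b hb =>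
    calc F a ≤ F y := hymax ha
      _ = F y / F x * F x := by field_simp
      _ ≤ F y / F x * F b := by gcongr; exact hxmin hb
  refine ⟨F y / F x, by linarith, fun a b ha hab => ?_⟩
  rcases le_total b T with hb | hb
  · exact key a ⟨ha, hab.trans hb⟩ b ⟨ha.trans hab, hb⟩
  rcases le_total a T with haT | haT
  · refine (key a ⟨ha, haT⟩ T ⟨hT, le_rfl⟩).trans ?_
    gcongr
    exact hmono (mem_Ici.2 le_rfl) (mem_Ici.2 hb) hb
  · exact (hmono (mem_Ici.2 haT) (mem_Ici.2 hb) hab).trans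
      (le_mul_of_one_le_left (hpos b (ha.trans hab)).le hM1)

theorem exists_le_mul_of_antitoneOn_Ici {F : ℝ → ℝ} (hF : ContinuousOn F (Ici 1))
    (hpos : ∀ t, 1 ≤ t → 0 < F t) {T : ℝ} (hT : 1 ≤ T) (hanti : AntitoneOn F (Ici T)) :
    ∃ M : ℝ, 0 < M ∧ ∀ a b, 1 ≤ a → a ≤ b → F b ≤ M * F a := by
  obtain ⟨M, hM, h⟩ := exists_le_mul_of_monotoneOn_Ici (F := fun t => (F t)⁻¹)
    (hF.inv₀ fun t ht => (hpos t ht).ne') (fun t ht => inv_pos.2 (hpos t ht)) hT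
    (fun a ha b hb hab => inv_anti₀ (hpos b (hT.trans hb)) (hanti ha hb hab))
  refine ⟨M, hM, fun a b ha hab => ?_⟩
  have h1 := h a b ha hab
  have ha0 := hpos a ha
  have hb0 := hpos b (ha.trans hab)
  rw [← div_eq_mul_inv, le_div_iff₀ hb0, inv_mul_le_iff₀ ha0] at h1
  linarith

/-- Potter-type bounds: up to a constant, `g` changes between `a` and `b` by at most the factor
`(b/a)^δ` in either direction. -/
theorem SlowlyVarying.exists_le_mul {g : ℝ → ℝ} (hg : g ∈ SlowlyVarying) {δ : ℝ} (hδ : 0 < δ) :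
    ∃ M : ℝ, 0 < M ∧ ∀ a b, 1 ≤ a → a ≤ b →
      g a ≤ M * (g b * (b / a) ^ δ) ∧ g b ≤ M * (g a * (b / a) ^ δ) := by
  obtain ⟨hc, hpos, hδT⟩ := hg
  obtain ⟨T, hT, hmono, hanti⟩ := hδT δ hδ
  have hpow : ∀ r : ℝ, ContinuousOn (fun t : ℝ => t ^ r) (Ici 1) := fun r =>
    continuousOn_id.rpow_const fun t ht => Or.inl (by
      have : (1 : ℝ) ≤ t := ht
      simp only [id]; linarith)
  have hpos' : ∀ r : ℝ, ∀ t, 1 ≤ t → 0 < g t * t ^ r := fun r t ht =>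
    mul_pos (hpos t ht) (Real.rpow_pos_of_pos (by linarith) r)
  obtain ⟨M₁, hM₁, h₁⟩ := exists_le_mul_of_monotoneOn_Ici (hc.mul (hpow δ)) (hpos' δ) hT hmono
  obtain ⟨M₂, hM₂, h₂⟩ := exists_le_mul_of_antitoneOn_Ici (hc.mul (hpow (-δ))) (hpos' (-δ)) hT hanti
  refine ⟨max M₁ M₂, lt_max_of_lt_left hM₁, fun a b ha hab => ?_⟩
  have ha0 : 0 < a := by linarith
  have hb0 : 0 < b := by linarith
  have hga := hpos a ha
  have hgb := hpos b (ha.trans hab)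
  have haδ := Real.rpow_pos_of_pos ha0 δ
  have hbδ := Real.rpow_pos_of_pos hb0 δ
  have e1 : g a * a ^ δ ≤ M₁ * (g b * b ^ δ) := h₁ a b ha hab
  have e2 : g b * b ^ (-δ) ≤ M₂ * (g a * a ^ (-δ)) := h₂ a b ha hab
  rw [Real.div_rpow hb0.le ha0.le]
  constructor
  · calc g a ≤ M₁ * (g b * (b ^ δ / a ^ δ)) := by
          rw [← mul_div_assoc, ← mul_div_assoc, le_div_iff₀ haδ]; exact e1
      _ ≤ _ := by gcongr; exact le_max_left _ _
  · rw [Real.rpow_neg ha0.le, Real.rpow_neg hb0.le, ← div_eq_mul_inv, ← div_eq_mul_inv,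
      div_le_iff₀ hbδ] at e2
    calc g b ≤ M₂ * (g a * (b ^ δ / a ^ δ)) := e2.trans (le_of_eq (by ring))
      _ ≤ _ := by gcongr; exact le_max_right _ _

theorem SlowlyVarying.continuousOn_rpow_div {g : ℝ → ℝ} (hg : g ∈ SlowlyVarying) (q : ℝ) :
    ContinuousOn (fun t => g t ^ q / t) (Ici 1) := by
  refine (hg.1.rpow_const fun t ht => Or.inl (hg.2.1 t ht).ne').div continuousOn_id fun t ht => ?_
  exact (lt_of_lt_of_le one_pos ht).ne'

theorem SlowlyVarying.intervalIntegrable_rpow_div {g : ℝ → ℝ} (hg : g ∈ SlowlyVarying) (q : ℝ) {a b : ℝ}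
    (ha : 1 ≤ a) (hb : 1 ≤ b) : IntervalIntegrable (fun t => g t ^ q / t) volume a b := by
  refine ((SlowlyVarying.continuousOn_rpow_div hg q).mono fun t ht => ?_).intervalIntegrable
  exact (le_min ha hb).trans ht.1

theorem SlowlyVarying.exists_sum_le_integral {g : ℝ → ℝ} (hg : g ∈ SlowlyVarying) {q : ℝ} (hq : 0 < q) :
    ∃ M : ℝ, 0 < M ∧ ∀ n : ℕ, 2 ≤ n →
      ∑ k ∈ Finset.Ico 1 n, 1 / (k : ℝ) * g k ^ q ≤ M * ∫ t in (1 : ℝ)..n, g t ^ q / t := by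
  obtain ⟨M, hM, h⟩ := SlowlyVarying.exists_le_mul hg one_pos
  have hpos := hg.2.1
  refine ⟨2 * (2 * M) ^ q, by positivity, fun n hn => ?_⟩
  have hsum : ∑ k ∈ Finset.Ico 1 n, ∫ t in (k : ℝ)..(k + 1 : ℕ), g t ^ q / t =
      ∫ t in ((1 : ℕ) : ℝ)..n, g t ^ q / t :=
    intervalIntegral.sum_integral_adjacent_intervals_Ico (by omega) fun k hk =>
      SlowlyVarying.intervalIntegrable_rpow_div hg q (by exact_mod_cast hk.1) (by exact_mod_cast (by omega))
  rw [Nat.cast_one] at hsum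
  rw [← hsum, Finset.mul_sum]
  refine Finset.sum_le_sum fun k hk => ?_
  have hk1 : (1 : ℝ) ≤ k := by exact_mod_cast (Finset.mem_Ico.1 hk).1
  rw [← intervalIntegral.integral_const_mul]
  have hi := SlowlyVarying.intervalIntegrable_rpow_div hg q hk1 (b := (k + 1 : ℕ))
    (by push_cast; linarith)
  calc 1 / (k : ℝ) * g k ^ q = ∫ _ in (k : ℝ)..(k + 1 : ℕ), 1 / (k : ℝ) * g k ^ q := by
        rw [intervalIntegral.integral_const]; push_cast; simp
    _ ≤ _ := by
        refine intervalIntegral.integral_mono_on (by push_cast; linarith) intervalIntegrable_const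
          (hi.const_mul _) fun t ht => ?_
        have ht1 : (k : ℝ) ≤ t := ht.1
        have ht2 : t ≤ k + 1 := by have := ht.2; push_cast at this; exact this
        have hgt := hpos t (hk1.trans ht1)
        have h1 : g k ≤ 2 * M * g t := by
          refine ((h k t hk1 ht1).1).trans ?_
          rw [Real.rpow_one]
          have : t / k ≤ 2 := by rw [div_le_iff₀ (by linarith)]; linarith
          calc M * (g t * (t / k)) ≤ M * (g t * 2) := by gcongr
            _ = _ := by ring
        have h2 : 1 / (k : ℝ) ≤ 2 / t := by
          rw [div_le_div_iff₀ (by linarith) (by linarith)]; linarith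
        calc 1 / (k : ℝ) * g k ^ q ≤ 2 / t * (2 * M * g t) ^ q := by
              have := (hpos k hk1).le
              have : 0 < t := by linarith
              gcongr
          _ = _ := by
              rw [Real.mul_rpow (by positivity) hgt.le]; ring

/-- On `[n/2, n]` the function `g` is comparable to `g n`, so this piece alone yields a multiple of
`g n ^ q`. The condition `n ≥ 2` keeps `n/2` in the domain. -/
theorem SlowlyVarying.exists_rpow_le_integral {g : ℝ → ℝ} (hg : g ∈ SlowlyVarying) {q : ℝ} (hq : 0 < q) :
    ∃ M : ℝ, 0 < M ∧ ∀ n : ℕ, 2 ≤ n → g n ^ q ≤ M * ∫ t in (1 : ℝ)..n, g t ^ q / t := by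
  obtain ⟨M, hM, h⟩ := SlowlyVarying.exists_le_mul hg one_pos
  have hpos := hg.2.1
  refine ⟨2 * (2 * M) ^ q, by positivity, fun n hn => ?_⟩
  have hn2 : (2 : ℝ) ≤ n := by exact_mod_cast hn
  have hn0 := (hpos n (by linarith)).le
  have hi := fun {a b : ℝ} => SlowlyVarying.intervalIntegrable_rpow_div hg q (a := a) (b := b)
  have hnn : 0 ≤ ∫ t in (1 : ℝ)..(n / 2 : ℝ), g t ^ q / t :=
    intervalIntegral.integral_nonneg (by linarith) fun t ht =>
      div_nonneg (Real.rpow_nonneg (hpos t ht.1).le q) (by linarith [ht.1])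
  have hsplit : ∫ t in (n / 2 : ℝ)..n, g t ^ q / t ≤ ∫ t in (1 : ℝ)..n, g t ^ q / t := by
    rw [← intervalIntegral.integral_add_adjacent_intervals (hi le_rfl (by linarith : (1 : ℝ) ≤ n / 2))
      (hi (by linarith) (by linarith))]
    linarith
  have key : ∫ _ in (n / 2 : ℝ)..n, g n ^ q / n ≤ ∫ t in (n / 2 : ℝ)..n, (2 * M) ^ q * (g t ^ q / t) := by
    refine intervalIntegral.integral_mono_on (by linarith) intervalIntegrable_const
      ((hi (by linarith) (by linarith)).const_mul _) fun t ht => ?_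
    have ht1 : 1 ≤ t := by linarith [ht.1]
    have hgt := hpos t ht1
    have h1 : g n ≤ 2 * M * g t := by
      refine ((h t n ht1 ht.2).2).trans ?_
      rw [Real.rpow_one]
      have : (n : ℝ) / t ≤ 2 := by rw [div_le_iff₀ (by linarith)]; linarith [ht.1]
      calc M * (g t * (n / t)) ≤ M * (g t * 2) := by gcongr
        _ = _ := by ring
    calc g n ^ q / n ≤ (2 * M * g t) ^ q / t := by
          gcongr
          exact ht.2
      _ = _ := by rw [Real.mul_rpow (by positivity) hgt.le]; ring
  rw [intervalIntegral.integral_const, intervalIntegral.integral_const_mul, smul_eq_mul,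
    show ((n : ℝ) - n / 2) * (g n ^ q / n) = g n ^ q / 2 by field_simp; ring] at key
  have := mul_le_mul_of_nonneg_left hsplit (by positivity : 0 ≤ (2 * M) ^ q)
  linarith

/-- In case 2 `ψ` is only eventually non-increasing. The finitely many earlier ratios are absorbed
into `C`, chosen as a sum that dominates each of them. -/
theorem exists_growth_of_eventually_antitone {u : ℕ → ℝ} (hpos : ∀ k, 1 ≤ k → 0 < u k) {N : ℕ}
    (hN : ∀ k, N ≤ k → u (k + 1) ≤ u k) :
    ∃ C : ℝ, 0 ≤ C ∧ ∀ k : ℕ, 1 ≤ k → u (k + 1) ≤ (1 + C / k) * u k := by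
  have hnn : ∀ k ∈ Finset.Ico 1 (N + 1), 0 ≤ k * u (k + 1) / u k := fun k hk => by
    have := hpos k (Finset.mem_Ico.1 hk).1
    have := hpos (k + 1) (by omega)
    positivity
  refine ⟨∑ k ∈ Finset.Ico 1 (N + 1), k * u (k + 1) / u k, Finset.sum_nonneg hnn, fun k hk => ?_⟩
  have hk0 : (0 : ℝ) < k := by exact_mod_cast hk
  have hu := hpos k hk
  have hS := Finset.sum_nonneg hnn
  rcases le_or_gt N k with h | h
  · exact (hN k h).trans (le_mul_of_one_le_left hu.le (by linarith [div_nonneg hS hk0.le]))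
  · have h1 := Finset.single_le_sum hnn (Finset.mem_Ico.2 ⟨hk, by omega⟩)
    calc u (k + 1) = (k * u (k + 1) / u k) / k * u k := by field_simp
      _ ≤ (∑ k ∈ Finset.Ico 1 (N + 1), k * u (k + 1) / u k) / k * u k := by gcongr
      _ ≤ _ := by nlinarith

/-- The sum is split at `n`. Above `n`, the Potter-type bound with exponent `s/2` consumes half of
the decay `(n/k)^s`; the other half makes the tail comparable to the term at `n`. -/
theorem SlowlyVarying.exists_energy_le {ψ : ℝ → ℝ} {s p q : ℝ} (hpq : p.HolderConjugate q)
    (hs : 0 < s) (hg : gFun ψ s p ∈ SlowlyVarying) :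
    ∃ A : ℝ, 0 < A ∧ ∀ n : ℕ, 1 ≤ n → energy p q (errorCoeff ψ s n) ≤
      ENNReal.ofReal ((1 / (n : ℝ) ^ s) ^ q *
        (∑ k ∈ Finset.Ico 1 n, 1 / (k : ℝ) * gFun ψ s p k ^ q + A * gFun ψ s p n ^ q)) := by
  have hq := hpq.symm.pos
  have hpos := hg.2.1
  obtain ⟨M, hM, h⟩ := SlowlyVarying.exists_le_mul hg (half_pos hs)
  have hs2 : 0 < min (s / 2) 1 := lt_min (half_pos hs) one_pos
  refine ⟨M ^ q * (2 / min (s / 2) 1), by positivity, fun n hn => ?_⟩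
  have hn1 : (1 : ℝ) ≤ n := by exact_mod_cast hn
  have hgn := (hpos n hn1).le
  set w := errorCoeff ψ s n
  have hhigh : energy p q (fun k => if k < n then 0 else w k) ≤
      ENNReal.ofReal ((1 / (n : ℝ) ^ s) ^ q * (M ^ q * (2 / min (s / 2) 1) * gFun ψ s p n ^ q)) := by
    refine (energy_le_of_le_ratioKernel hpq (half_pos hs) hn
      (X := 1 / (n : ℝ) ^ s * (M * gFun ψ s p n)) (by positivity) fun k hk => ?_).trans (le_of_eq ?_)
    · have hk1 : (1 : ℝ) ≤ k := by exact_mod_cast hk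
      split_ifs with hkn
      · rw [zero_mul]
        exact mul_nonneg (by positivity) (ratioKernel_nonneg _ _ _)
      · have hnk : n ≤ k := not_lt.1 hkn
        rw [errorCoeff_mul_of_ge hs hn hnk, ratioKernel_of_ge _ hnk, mul_assoc]
        gcongr 1 / _ * ?_
        have hr : (0 : ℝ) < (n : ℝ) / k := by positivity
        calc ((n : ℝ) / k) ^ s * gFun ψ s p k
            ≤ ((n : ℝ) / k) ^ s * (M * (gFun ψ s p n * ((k : ℝ) / n) ^ (s / 2))) := by
              gcongr
              exact (h n k hn1 (by exact_mod_cast hnk)).2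
          _ = M * gFun ψ s p n * ((n : ℝ) / k) ^ (s / 2) := by
              rw [← inv_div (n : ℝ) k, Real.inv_rpow hr.le]
              conv_lhs => rw [← add_halves s, Real.rpow_add hr]
              simp only [add_halves]
              field_simp
    · rw [ENNReal.ofReal_rpow_of_nonneg (by positivity) hq.le, ← ENNReal.ofReal_mul (by positivity),
        Real.mul_rpow (by positivity) (by positivity), Real.mul_rpow hM.le hgn]
      congr 1; ring
  have hlow : energy p q (fun k => if k < n then w k else 0) ≤
      ENNReal.ofReal ((1 / (n : ℝ) ^ s) ^ q *
        ∑ k ∈ Finset.Ico 1 n, 1 / (k : ℝ) * gFun ψ s p k ^ q) := by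
    have hnn : ∀ k ∈ Finset.Ico 1 n, 0 ≤ 1 / (k : ℝ) * gFun ψ s p k ^ q := fun k hk =>
      mul_nonneg (by positivity)
        (Real.rpow_nonneg (hpos k (by exact_mod_cast (Finset.mem_Ico.1 hk).1)).le q)
    rw [energy, tsum_eq_sum (s := Finset.Ico 1 n) fun k hk => ?_, ENNReal.ofReal_mul (by positivity),
      ENNReal.ofReal_sum_of_nonneg hnn, Finset.mul_sum]
    · refine Finset.sum_le_sum fun k hk => le_of_eq ?_
      obtain ⟨hk1, hkn⟩ := Finset.mem_Ico.1 hk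
      have hgk := (hpos k (by exact_mod_cast hk1)).le
      rw [if_pos hkn, errorCoeff_mul_of_le hs hk1 hkn.le, ENNReal.ofReal_rpow_of_nonneg (by positivity) hq.le,
        Real.mul_rpow (by positivity) hgk, ← ENNReal.ofReal_mul (by positivity),
        ← ENNReal.ofReal_mul (by positivity)]
      congr 1; ring
    · rcases Nat.eq_zero_or_pos k with rfl | hk1
      · simp
      · rw [if_neg fun hkn => hk (Finset.mem_Ico.2 ⟨hk1, hkn⟩)]
        simp [hq]
  calc energy p q w ≤ energy p q (fun k => if k < n then w k else 0) +
        energy p q (fun k => if k < n then 0 else w k) := by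
        rw [energy, energy, energy, ← ENNReal.tsum_add]
        refine ENNReal.tsum_le_tsum fun k => ?_
        split_ifs with hkn
        · exact le_self_add
        · exact le_add_self
    _ ≤ _ := add_le_add hlow hhigh
    _ = _ := by
        rw [← ENNReal.ofReal_add]
        · congr 1; ring
        · exact mul_nonneg (by positivity) (Finset.sum_nonneg fun k hk => mul_nonneg (by positivity)
            (Real.rpow_nonneg (hpos k (by exact_mod_cast (Finset.mem_Ico.1 hk).1)).le q))
        · positivity

theorem exists_zygmundError_le_of_slowlyVarying {ψ : ℝ → ℝ} {s p : ℝ} (hp : 1 < p) (hs : 0 < s)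
    (hg : gFun ψ s p ∈ SlowlyVarying) :
    (∀ β : ℝ, HasKernel ψ β p) ∧ ∃ K : ℝ, 0 < K ∧ ∀ (β : ℝ) (n : ℕ), 2 ≤ n →
      zygmundError ψ β p s n ≤ ENNReal.ofReal (K * (1 / (n : ℝ) ^ s *
        (∫ t in (1 : ℝ)..n, gFun ψ s p t ^ p.conjExponent / t) ^ (1 / p.conjExponent))) := by
  have hpq : p.HolderConjugate p.conjExponent := Real.HolderConjugate.conjExponent hp
  set q := p.conjExponent
  have hq := hpq.symm.pos
  have hp0 : 0 < p := by linarith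
  have hpos := hg.2.1
  have hψpos : ∀ k : ℕ, 1 ≤ k → 0 < ψ k := fun k hk => by
    have hk1 : (1 : ℝ) ≤ k := by exact_mod_cast hk
    exact pos_of_gFun_pos (by linarith) (hpos k hk1)
  -- With `δ = s`, the function `g(t) t^(-s) = ψ(t) t^(1/p)` is eventually non-increasing, hence so
  -- is `ψ`.
  obtain ⟨T, hT, -, hanti⟩ := hg.2.2 s hs
  have hψ : ∀ k : ℕ, 1 ≤ k → ψ k = gFun ψ s p k * (k : ℝ) ^ (-s) * (k : ℝ) ^ (-(1 / p)) := fun k hk => by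
    have hk0 : (0 : ℝ) < k := by exact_mod_cast hk
    rw [gFun_eq_mul hk0, Real.rpow_neg hk0.le, Real.rpow_neg hk0.le]; field_simp
  obtain ⟨C, hC, hgrow⟩ := exists_growth_of_eventually_antitone (u := fun k : ℕ => ψ k) hψpos
    (N := ⌈T⌉₊) fun k hk => by
      have hTk : T ≤ k := Nat.ceil_le.1 hk
      have hk1 : (1 : ℝ) ≤ k := hT.trans hTk
      have hk1' : 1 ≤ k := by exact_mod_cast hk1
      have hkk : (k : ℝ) ≤ (k + 1 : ℕ) := by push_cast; linarith
      rw [hψ k hk1', hψ (k + 1) (by omega)]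
      have h1 := hanti (mem_Ici.2 hTk) (mem_Ici.2 (hTk.trans hkk)) hkk
      have h2 : ((k + 1 : ℕ) : ℝ) ^ (-(1 / p)) ≤ (k : ℝ) ^ (-(1 / p)) :=
        Real.rpow_le_rpow_of_nonpos (by linarith) hkk (by rw [neg_nonpos]; positivity)
      exact mul_le_mul h1 h2 (by positivity) (mul_nonneg (hpos k hk1).le (by positivity))
  obtain ⟨M, hM, hMab⟩ := SlowlyVarying.exists_le_mul hg hs
  obtain ⟨A, hA, hAn⟩ := SlowlyVarying.exists_energy_le hpq hs hg
  obtain ⟨h1, K, hK, hKn⟩ := hasKernel_and_exists_zygmundError_le hp hs (fun k hk => (hψpos k hk).le) hC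
    hgrow (B := M * gFun ψ s p 1) (a := 1 / p) (by positivity) (fun k hk => by
      have hk1 : (1 : ℝ) ≤ k := by exact_mod_cast hk
      have := (hMab 1 k le_rfl hk1).2
      rw [hψ k hk]
      gcongr ?_ * _
      rw [Real.rpow_neg (by linarith), ← div_eq_mul_inv, div_le_iff₀ (by positivity)]
      refine this.trans (le_of_eq ?_)
      rw [div_one]; ring) (ne_top_of_le_ne_top ENNReal.ofReal_ne_top (hAn 1 le_rfl))
  obtain ⟨M₁, hM₁, hS⟩ := SlowlyVarying.exists_sum_le_integral hg hq
  obtain ⟨M₂, hM₂, hR⟩ := SlowlyVarying.exists_rpow_le_integral hg hq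
  -- The integral absorbs both the sum below `n` (constant `M₁`) and the tail term `A * g n ^ q`
  -- (constant `A * M₂`). At `n = 1` it would vanish, hence `2 ≤ n`.
  refine ⟨h1, K * (M₁ + A * M₂) ^ (1 / q), by positivity, fun β n hn => (hKn β n (by omega)).trans ?_⟩
  have hn1 : (1 : ℝ) ≤ n := by exact_mod_cast (by omega : 1 ≤ n)
  set I := ∫ t in (1 : ℝ)..n, gFun ψ s p t ^ q / t
  have hI : 0 ≤ I := intervalIntegral.integral_nonneg hn1 fun t ht =>
    div_nonneg (Real.rpow_nonneg (hpos t ht.1).le q) (by linarith [ht.1])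
  have hen : energy p q (errorCoeff ψ s n) ≤
      ENNReal.ofReal ((1 / (n : ℝ) ^ s) ^ q * ((M₁ + A * M₂) * I)) := by
    refine (hAn n (by omega)).trans (ENNReal.ofReal_le_ofReal ?_)
    gcongr
    have := mul_le_mul_of_nonneg_left (hR n hn) hA.le
    linarith [hS n hn]
  rw [mul_assoc K, ENNReal.ofReal_mul hK.le]
  gcongr
  refine (ENNReal.rpow_le_rpow hen (by positivity)).trans (le_of_eq ?_)
  rw [ENNReal.ofReal_rpow_of_nonneg (by positivity) (by positivity),
    Real.mul_rpow (by positivity) (by positivity), ← Real.rpow_mul (by positivity),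
    mul_one_div_cancel hq.ne', Real.rpow_one, Real.mul_rpow (by positivity) hI]
  congr 1; ring

end ZygmundApprox

theorem mainTheorem1 (p s : ℝ) (hp : 1 < p) (hs : 0 < s)
    (ψ : ℝ → ℝ) (hψ : ContinuousOn ψ (Ici 1)) :
    (ψ ∈ Theta p → gFun ψ s p ∈ APlus →
      (∀ β : ℝ, HasKernel ψ β p) ∧
      ∃ K : ℝ, 0 < K ∧ ∀ (β : ℝ) (n : ℕ), 1 ≤ n →
        zygmundError ψ β p s n ≤ ENNReal.ofReal (K * (ψ n * (n : ℝ) ^ (1 / p)))) ∧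
    (gFun ψ s p ∈ SlowlyVarying →
      (∀ β : ℝ, HasKernel ψ β p) ∧
      ∃ K : ℝ, 0 < K ∧ ∀ (β : ℝ) (n : ℕ), 2 ≤ n →
        zygmundError ψ β p s n ≤ ENNReal.ofReal (K * (1 / (n : ℝ) ^ s *
          (∫ t in (1 : ℝ)..n, gFun ψ s p t ^ p.conjExponent / t) ^ (1 / p.conjExponent)))) ∧
    (gFun ψ s p ∈ AMinus →
      (∀ β : ℝ, HasKernel ψ β p) ∧
      ∃ K : ℝ, 0 < K ∧ ∀ (β : ℝ) (n : ℕ), 1 ≤ n →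
        zygmundError ψ β p s n ≤ ENNReal.ofReal (K * (1 / (n : ℝ) ^ s))) := by
  exact ⟨exists_zygmundError_le_of_theta hp hs, exists_zygmundError_le_of_slowlyVarying hp hs,
    exists_zygmundError_le_of_aminus hp hs⟩
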